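/- **Setting.** Let $S$ be a finite-level system with Hamiltonian $H_S=\sum_i\epsilon_i|\epsilon_i\rangle\langle\epsilon_i|$ (degeneracies allowed) and let $W$ be the weight, with Hilbert space $L^2(\mathbb R)$, Hamiltonian $(H_W\varphi)(E)=E\,\varphi(E)$ and displacements $(\Gamma_a\varphi)(E)=(e^{-ia\Delta_W}\varphi)(E)=\varphi(E-a)$. For a density matrix $\rho$ of $S$ and a unitary $V$ of $S$ put $W_V=H_S-V^\dagger H_SV$ and define the ergotropy $R(\rho)=\max_V \mathrm{Tr}[W_V\rho]$, the incoherent ergotropy $R_I(\rho)=\max\{\mathrm{Tr}[W_V\rho] : [W_V,H_S]=0\}$, and the coherent ergotropy $R_C(\rho)=R(\rho)-R_I(\rho)$. For density operators $\rho_S$ of $S$ and $\rho_W$ of $W$, the control-marginal state is $\sigma_S=\mathrm{Tr}_W[\mathsf S(\rho_S\otimes\rho_W)\mathsf S^\dagger]$, where $\mathsf S=e^{-iH_S\otimes\Delta_W}=\sum_i|\epsilon_i\rangle\langle\epsilon_i|\otimes\Gamma_{\epsilon_i}$. Let $U$ be a unitary on $\mathbb C^n\otimes L^2(\mathbb R)$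 with $[U,H_S+H_W]=0$ and $[U,\Delta_W]=0$ (in the sense of commuting with the unitary groups generated by $H_S+H_W$ and $\Delta_W$). The initial and final energy dispersions $\sigma_E^{(i)},\sigma_E^{(f)}\in[0,\infty]$ are the standard deviations of the energy distribution of $H_W$ in the states $\rho_W$ and $\mathrm{Tr}_S[U(\rho_S\otimes\rho_W)U^\dagger]$ respectively. **Corollary.** Suppose that $\rho_S$ has positive coherent ergotropy, $R_C(\rho_S)>0$. 1. If the total ergotropy is unlocked, i.e. $R(\rho_S)=R(\sigma_S)$, then $\sigma_E^{(i)}=\sigma_E^{(f)}=\infty$, for every admissible $U$. 2. More generally, let $\rho_W^{(k)}$ be any sequence of density operators of the weight, with control-marginal states $\sigma_S^{(k)}$, and let $U_k$ be any sequence of admissible unitaries. If the total ergotropy is unlocked in the limit, i.e. $R(\sigma_S^{(k)})\to R(\rho_S)$ as $k\to\infty$, then the initial and final dispersions diverge: $\sigma_E^{(i,k)}\to\infty$ and $\sigma_E^{(f,k)}\to\infty$. -/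

import Mathlib

open scoped Matrix ENNReal InnerProductSpace ComplexOrder Topology

namespace QuantumWeight

noncomputable section

/-! ### The finite-level system

The Hilbert space of the system is `ℂⁿ`, written in an orthonormal basis of energy eigenvectors. The
energies `ε i` are arbitrary real numbers (degeneracies are allowed). -/

section System

variable {n : Type*} [Fintype n] [DecidableEq n]

/-- The system Hamiltonian `H_S = ∑ i, ε i |ε i⟩⟨ε i|`. -/
def systemHamiltonian (ε : n → ℝ) : Matrix n n ℂ :=
  Matrix.diagonal fun i => (ε i : ℂ)

/-- The work operator `W_S = H_S - V† H_S V` of a unitary `V` of the system. -/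
def workOperator (ε : n → ℝ) (V : Matrix n n ℂ) : Matrix n n ℂ :=
  systemHamiltonian ε - Vᴴ * systemHamiltonian ε * V

/-- A density matrix of the system. -/
structure IsDensityMatrix (ρ : Matrix n n ℂ) : Prop where
  posSemidef : ρ.PosSemidef
  trace_eq_one : ρ.trace = 1

/-- The ergotropy `R(ρ)`: the maximum of `Tr[W_S ρ]` over all unitaries of the system. -/
def ergotropy (ε : n → ℝ) (ρ : Matrix n n ℂ) : ℝ :=
  ⨆ V : Matrix.unitaryGroup n ℂ, ((workOperator ε (V : Matrix n n ℂ) * ρ).trace).re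

/-- The incoherent ergotropy `R_I(ρ)`: the maximum of `Tr[W_S ρ]` over the incoherent unitaries,
those whose work operator commutes with `H_S`. (If the energies are pairwise distinct, these are
exactly the unitaries that permute the energy eigenstates up to phases.) -/
def incoherentErgotropy (ε : n → ℝ) (ρ : Matrix n n ℂ) : ℝ :=
  ⨆ V : {V : Matrix.unitaryGroup n ℂ //
      Commute (workOperator ε (V : Matrix n n ℂ)) (systemHamiltonian ε)},
    ((workOperator ε (V.1 : Matrix n n ℂ) * ρ).trace).re

/-- The coherent ergotropy `R_C(ρ) = R(ρ) - R_I(ρ)`. -/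
def coherentErgotropy (ε : n → ℝ) (ρ : Matrix n n ℂ) : ℝ :=
  ergotropy ε ρ - incoherentErgotropy ε ρ

end System

/-! ### The weight -/

/-- The Hilbert space `L²(ℝ)` of the weight in the energy representation: the Hamiltonian `H_W` is
multiplication by the variable `E`. -/
abbrev WeightSpace : Type := MeasureTheory.Lp ℂ 2 (MeasureTheory.volume : MeasureTheory.Measure ℝ)

/-- The displacement operator `Γ_a = exp(-i a Δ_W)`, `(Γ_a φ)(E) = φ(E - a)`, so that
`Γ_a |E⟩ = |E + a⟩` and `Γ_a† H_W Γ_a = H_W + a`. -/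
def displacement (a : ℝ) : WeightSpace →L[ℂ] WeightSpace :=
  (MeasureTheory.Lp.compMeasurePreservingₗᵢ ℂ (fun E : ℝ => E - a)
    (MeasureTheory.measurePreserving_sub_right MeasureTheory.volume a)).toContinuousLinearMap

theorem displacement_apply (a : ℝ) (φ : WeightSpace) :
    displacement a φ =ᵐ[MeasureTheory.volume] fun E => φ (E - a) :=
  MeasureTheory.Lp.coeFn_compMeasurePreserving φ
    (MeasureTheory.measurePreserving_sub_right MeasureTheory.volume a)

theorem memLp_phase (s : ℝ) :
    MeasureTheory.MemLp (fun E : ℝ => Complex.exp (Complex.I * s * E)) ∞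
      MeasureTheory.volume := by
  refine MeasureTheory.memLp_top_of_bound
    (by fun_prop : Continuous fun E : ℝ => Complex.exp (Complex.I * s * E)).aestronglyMeasurable
    1 (Filter.Eventually.of_forall fun E => ?_)
  simp [Complex.norm_exp]

/-- The free evolution `exp(i s H_W)`: multiplication by `E ↦ exp(i s E)`. -/
def weightPhase (s : ℝ) : WeightSpace →L[ℂ] WeightSpace :=
  (ContinuousLinearMap.lsmul ℂ ℂ).holderL MeasureTheory.volume ∞ 2 2 (memLp_phase s).toLp

theorem weightPhase_apply (s : ℝ) (φ : WeightSpace) :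
    weightPhase s φ =ᵐ[MeasureTheory.volume]
      fun E => Complex.exp (Complex.I * s * E) * φ E := by
  have h1 := (ContinuousLinearMap.lsmul ℂ ℂ).coeFn_holder (r := 2) (memLp_phase s).toLp φ
  filter_upwards [h1, (memLp_phase s).coeFn_toLp] with E h1 h2
  rw [← h2]
  exact h1

/-- The index set of a fixed orthonormal basis of the weight space. -/
def weightIndex : Set WeightSpace := (exists_hilbertBasis ℂ WeightSpace).choose

/-- A fixed orthonormal (Hilbert) basis of the weight space, used to write down traces. -/
def weightBasis : HilbertBasis weightIndex ℂ WeightSpace :=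
  (exists_hilbertBasis ℂ WeightSpace).choose_spec.choose

/-- The trace `Tr A = ∑ k, ⟨b k, A b k⟩` of a trace-class operator on the weight space. -/
def weightTrace (A : WeightSpace →L[ℂ] WeightSpace) : ℂ :=
  ∑' k, ⟪weightBasis k, A (weightBasis k)⟫_ℂ

/-- A density operator of the weight: a positive operator with trace one. -/
structure IsDensityOperator (ρ : WeightSpace →L[ℂ] WeightSpace) : Prop where
  isPositive : ρ.IsPositive
  hasSum_trace : HasSum (fun k => ⟪weightBasis k, ρ (weightBasis k)⟫_ℂ) 1

/-- The positive square root of a positive operator on a complex Hilbert space. -/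
def operatorSqrt {H : Type*} [NormedAddCommGroup H] [InnerProductSpace ℂ H] [CompleteSpace H]
    (A : H →L[ℂ] H) : H →L[ℂ] H :=
  CFC.sqrt A

/-- The energy distribution of a weight state `ρ`, i.e. the measure
`B ↦ Tr[√ρ 1_B(H_W) √ρ] = Tr[ρ 1_B(H_W)]`. Its density is
`f(E) = ⟨E|ρ|E⟩ = ∑ k, |(√ρ b k)(E)|²`. -/
def energyDistribution (ρ : WeightSpace →L[ℂ] WeightSpace) : MeasureTheory.Measure ℝ :=
  MeasureTheory.Measure.sum fun k =>
    MeasureTheory.volume.withDensity fun E => ‖(operatorSqrt ρ (weightBasis k)) E‖ₑ ^ 2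

/-- The energy dispersion `σ_E ∈ [0, ∞]`: the standard deviation of the energy distribution. It is
`∞` exactly when the energy distribution has an infinite second moment. -/
def energyDispersion (ρ : WeightSpace →L[ℂ] WeightSpace) : ℝ≥0∞ :=
  (ProbabilityTheory.evariance (fun E : ℝ => E) (energyDistribution ρ)) ^ (1 / 2 : ℝ)

/-! ### System and weight together

Operators on `ℂⁿ ⊗ L²(ℝ) ≅ L²(ℝ)ⁿ` are `n × n` matrices of operators on `L²(ℝ)`; the entry `A i j` is
`⟨ε i| A |ε j⟩`. Product and adjoint are those of matrices over the star ring of operators. -/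

section Composite

variable {n : Type*} [Fintype n] [DecidableEq n]

/-- Operators on the composite Hilbert space `ℂⁿ ⊗ L²(ℝ)`. -/
abbrev CompositeOperator (n : Type*) : Type _ := Matrix n n (WeightSpace →L[ℂ] WeightSpace)

/-- The product operator `A ⊗ B`. -/
def tensor (A : Matrix n n ℂ) (B : WeightSpace →L[ℂ] WeightSpace) : CompositeOperator n :=
  Matrix.of fun i j => A i j • B

/-- The partial trace over the system, `Tr_S A = ∑ i, ⟨ε i| A |ε i⟩`. -/
def partialTraceSystem (A : CompositeOperator n) : WeightSpace →L[ℂ] WeightSpace :=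
  ∑ i, A i i

/-- The partial trace over the weight, `⟨ε i| Tr_W A |ε j⟩ = Tr ⟨ε i| A |ε j⟩`. -/
def partialTraceWeight (A : CompositeOperator n) : Matrix n n ℂ :=
  Matrix.of fun i j => weightTrace (A i j)

/-- The operator `S = exp(-i H_S ⊗ Δ_W) = ∑ i, |ε i⟩⟨ε i| ⊗ Γ_{ε i}`. -/
def controlOperator (ε : n → ℝ) : CompositeOperator n :=
  Matrix.diagonal fun i => displacement (ε i)

/-- The control-marginal state `σ_S = Tr_W[S (ρ_S ⊗ ρ_W) S†]`. -/
def controlMarginal (ε : n → ℝ) (ρS : Matrix n n ℂ) (ρW : WeightSpace →L[ℂ] WeightSpace) :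
    Matrix n n ℂ :=
  partialTraceWeight (controlOperator ε * tensor ρS ρW * star (controlOperator ε))

/-- The total free evolution `exp(i s (H_S + H_W))`. -/
def freeEvolution (ε : n → ℝ) (s : ℝ) : CompositeOperator n :=
  Matrix.diagonal fun i => Complex.exp (Complex.I * s * ε i) • weightPhase s

/-- The admissible work-extraction unitaries: `[U, H_S + H_W] = 0` (energy conservation) and
`[U, Δ_W] = 0` (translation invariance). The commutators with the unbounded self-adjoint generators
are expressed through the unitary groups that they generate. -/
structure IsWorkExtraction (ε : n → ℝ) (U : CompositeOperator n) : Prop where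
  mem_unitary : U ∈ unitary (CompositeOperator n)
  energy_conserving : ∀ s : ℝ, Commute U (freeEvolution ε s)
  translation_invariant : ∀ a : ℝ, Commute U (tensor 1 (displacement a))

/-- The final state `Tr_S[U (ρ_S ⊗ ρ_W) U†]` of the weight. -/
def finalWeightState (U : CompositeOperator n) (ρS : Matrix n n ℂ)
    (ρW : WeightSpace →L[ℂ] WeightSpace) : WeightSpace →L[ℂ] WeightSpace :=
  partialTraceSystem (U * tensor ρS ρW * star U)

end Composite

end

end QuantumWeight

namespace QuantumWeight

noncomputable section

open MeasureTheory

/-! ### Commuting contractions and positive operators -/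

/-! For a unitary `V` of the system, the deficit R(ρ_S) - Tr[W_V σ_S] is the expectation in the
weight state of X = ∑ (V† H_S V)_{ji} ρ_{ij} Γ_{ε_i - ε_j} - E_min, where E_min is the least mean
energy reached from ρ_S by unitaries. This X is a trigonometric polynomial in Δ_W whose frequencies
are energy gaps. It is positive by Birkhoff's theorem (`displacementHom_excessSymbol_isPositive`).
Its zeroth coefficient is the excess of Tr[V† H_S V ρ] over E_min for the dephased ρ, hence at least
R_C(ρ_S) for every `V` (`passiveEnergy_add_coherentErgotropy_le`).

A nonnegative trigonometric polynomial with non-zero mean is small only near its zeros, whereas a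
state confined in energy is too spread out in the conjugate variable to sit there.
`norm_sq_le_inner_add_cutoff` makes this quantitative. Conjugation by phases exp(i s H_W) translates
X, and Lagrange interpolation recovers the zeroth coefficient from finitely many translates, which
therefore have no common approximate kernel. So the product of the commuting contractions 1 - X_k/M,
one for each translate X_k, is a strict contraction. A phase is nearly a scalar on a vector confined
in energy; if X nearly annihilated such a vector, all the contractions, and a high power of their
product, would nearly fix it, so it would be small. Powers of contractions do not amplify the error
from the energy tail, so the tolerated tail `η` is the same for all interval lengths
(`exists_ergotropy_controlMarginal_add_le`).

Chebyshev's inequality turns a bound on a dispersion into an interval with tail at most `η`. For the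
final state, energy conservation forces each block of U to shift the weight energy by a fixed system
gap, so a small final tail implies a small initial tail on a slightly longer interval. A bound `C`
on either dispersion thus costs an amount `δ > 0` of ergotropy that does not depend on ρ_W or U, and
both claims follow. -/

theorem norm_sub_pow_apply_le {H : Type*} [NormedAddCommGroup H] [NormedSpace ℂ H]
    (A : H →L[ℂ] H) (hA : ∀ φ, ‖A φ‖ ≤ ‖φ‖) (J : ℕ) (φ : H) :
    ‖φ - (A ^ J) φ‖ ≤ J * ‖φ - A φ‖ := by
  induction J with
  | zero => simp
  | succ J ih =>
    have h : φ - (A ^ (J + 1)) φ = (φ - A φ) + A (φ - (A ^ J) φ) := by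
      simp [pow_succ', map_sub]
    rw [h]
    calc _ ≤ ‖φ - A φ‖ + ‖A (φ - (A ^ J) φ)‖ := norm_add_le _ _
      _ ≤ ‖φ - A φ‖ + J * ‖φ - A φ‖ := by
        gcongr
        exact (hA _).trans ih
      _ = _ := by push_cast; ring

theorem norm_pow_apply_le {H : Type*} [NormedAddCommGroup H] [NormedSpace ℂ H]
    (A : H →L[ℂ] H) (c : ℝ) (hc : 0 ≤ c) (hA : ∀ φ, ‖A φ‖ ≤ c * ‖φ‖) (J : ℕ) (φ : H) :
    ‖(A ^ J) φ‖ ≤ c ^ J * ‖φ‖ := by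
  induction J with
  | zero => simp
  | succ J ih =>
    rw [pow_succ', mul_apply_eq_comp, pow_succ', mul_assoc]
    exact (hA _).trans (mul_le_mul_of_nonneg_left ih hc)

section Commuting

variable {ι 𝒜 H : Type*} [CommRing 𝒜] [NormedAddCommGroup H] [NormedSpace ℂ H]
  [DecidableEq ι]

theorem norm_prod_apply_le (π : 𝒜 →+* (H →L[ℂ] H)) (a : ι → 𝒜)
    (ha : ∀ i φ, ‖π (a i) φ‖ ≤ ‖φ‖) (s : Finset ι) (φ : H) :
    ‖π (∏ i ∈ s, a i) φ‖ ≤ ‖φ‖ := by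
  induction s using Finset.induction_on with
  | empty => simp
  | insert i s hi ih =>
    rw [Finset.prod_insert hi, map_mul, mul_apply_eq_comp]
    exact (ha _ _).trans ih

theorem norm_sub_prod_apply_le (π : 𝒜 →+* (H →L[ℂ] H)) (a : ι → 𝒜)
    (ha : ∀ i φ, ‖π (a i) φ‖ ≤ ‖φ‖) (s : Finset ι) (φ : H) :
    ‖φ - π (∏ i ∈ s, a i) φ‖ ≤ ∑ i ∈ s, ‖φ - π (a i) φ‖ := by
  induction s using Finset.induction_on with
  | empty => simp
  | insert i s hi ih =>
    rw [Finset.prod_insert hi, map_mul, mul_apply_eq_comp, Finset.sum_insert hi]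
    have h : φ - π (a i) (π (∏ i ∈ s, a i) φ)
        = (φ - π (a i) φ) + π (a i) (φ - π (∏ i ∈ s, a i) φ) := by
      simp [map_sub]
    rw [h]
    exact (norm_add_le _ _).trans (by gcongr; exact (ha _ _).trans ih)

/-- If finitely many commuting contractions are jointly strictly contractive, then a vector that
is almost fixed by a high power of each of them is small. -/
theorem norm_le_of_commuting_contractions (π : 𝒜 →+* (H →L[ℂ] H)) (a : ι → 𝒜)
    (ha : ∀ i φ, ‖π (a i) φ‖ ≤ ‖φ‖) (s : Finset ι) (hs : s.Nonempty) (θ : ℝ)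
    (hθ : 0 ≤ θ) (hsum : ∀ φ, ∑ i ∈ s, ‖π (a i) φ‖ ^ 2 ≤ s.card * (θ * ‖φ‖ ^ 2))
    (J : ℕ) (φ : H) :
    ‖φ‖ ≤ √θ ^ J * ‖φ‖ + ∑ i ∈ s, ‖φ - (π (a i) ^ J) φ‖ := by
  have hcard : (0 : ℝ) < s.card := by exact_mod_cast hs.card_pos
  have h1 : ∀ φ, ‖π (∏ i ∈ s, a i) φ‖ ≤ √θ * ‖φ‖ := by
    intro φ
    -- By commutativity any one factor may act first, the others being contractions; averaging over
    -- `i` yields the strict bound.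
    have h2 : ∀ i ∈ s, ‖π (∏ i ∈ s, a i) φ‖ ^ 2 ≤ ‖π (a i) φ‖ ^ 2 := by
      intro i hi
      rw [← Finset.mul_prod_erase s a hi, mul_comm, map_mul, mul_apply_eq_comp]
      gcongr
      exact norm_prod_apply_le π a ha _ _
    have h3 := Finset.sum_le_sum h2
    rw [Finset.sum_const, nsmul_eq_mul] at h3
    have h4 := le_of_mul_le_mul_left (h3.trans (hsum φ)) hcard
    rw [← Real.sqrt_sq (norm_nonneg φ), ← Real.sqrt_mul hθ]
    exact Real.le_sqrt_of_sq_le h4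
  have h5 := norm_pow_apply_le _ _ (Real.sqrt_nonneg θ) h1 J φ
  have h6 := norm_sub_prod_apply_le π (fun i => a i ^ J)
    (fun i φ => by
      rw [map_pow]
      simpa using norm_pow_apply_le (π (a i)) 1 zero_le_one (by simpa using ha i) J φ) s φ
  rw [Finset.prod_pow] at h6
  simp only [map_pow] at h6
  calc ‖φ‖ = ‖(π (∏ i ∈ s, a i) ^ J) φ + (φ - (π (∏ i ∈ s, a i) ^ J) φ)‖ := by simp
    _ ≤ _ := (norm_add_le _ _).trans (add_le_add h5 h6)

end Commuting

/-! ### Positive operators and their square roots -/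

section Positive

variable {H : Type*} [NormedAddCommGroup H] [InnerProductSpace ℂ H] [CompleteSpace H]

theorem operatorSqrt_isPositive (A : H →L[ℂ] H) : (operatorSqrt A).IsPositive :=
  (ContinuousLinearMap.nonneg_iff_isPositive _).1 (CFC.sqrt_nonneg A)

theorem operatorSqrt_adjoint (A : H →L[ℂ] H) :
    ContinuousLinearMap.adjoint (operatorSqrt A) = operatorSqrt A :=
  (operatorSqrt_isPositive A).isSelfAdjoint.adjoint_eq

theorem operatorSqrt_mul_self {A : H →L[ℂ] H} (hA : A.IsPositive) :
    operatorSqrt A * operatorSqrt A = A :=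
  CFC.sqrt_mul_sqrt_self A ((ContinuousLinearMap.nonneg_iff_isPositive A).2 hA)

theorem inner_apply_eq_operatorSqrt {A : H →L[ℂ] H} (hA : A.IsPositive) (φ ψ : H) :
    ⟪φ, A ψ⟫_ℂ = ⟪operatorSqrt A φ, operatorSqrt A ψ⟫_ℂ := by
  conv_lhs => rw [← operatorSqrt_mul_self hA, mul_apply_eq_comp]
  rw [← ContinuousLinearMap.adjoint_inner_left, operatorSqrt_adjoint]

theorem norm_sq_apply_le_of_isPositive {A : H →L[ℂ] H} (hA : A.IsPositive) {M : ℝ}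
    (hM : ‖A‖ ≤ M) (φ : H) : ‖A φ‖ ^ 2 ≤ M * (⟪φ, A φ⟫_ℂ).re := by
  have h1 : (⟪φ, A φ⟫_ℂ).re = ‖operatorSqrt A φ‖ ^ 2 := by
    rw [inner_apply_eq_operatorSqrt hA, inner_self_eq_norm_sq_to_K]
    norm_cast
  have h2 : ‖operatorSqrt A‖ ^ 2 = ‖A‖ := by
    have := ContinuousLinearMap.norm_adjoint_comp_self (operatorSqrt A)
    rw [operatorSqrt_adjoint] at this
    rw [pow_two, ← this]
    congr 1
    exact operatorSqrt_mul_self hA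
  rw [h1]
  calc ‖A φ‖ ^ 2 = ‖operatorSqrt A (operatorSqrt A φ)‖ ^ 2 := by
        conv_lhs => rw [← operatorSqrt_mul_self hA, mul_apply_eq_comp]
    _ ≤ (‖operatorSqrt A‖ * ‖operatorSqrt A φ‖) ^ 2 := by
        gcongr; exact ContinuousLinearMap.le_opNorm _ _
    _ = ‖A‖ * ‖operatorSqrt A φ‖ ^ 2 := by rw [mul_pow, h2]
    _ ≤ _ := by gcongr

/-- Expand the square and use ‖Aφ‖² ≤ M ⟨φ, Aφ⟩ once: of the cross term -2⟨φ, Aφ⟩/M, half cancels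
the quadratic term and half remains as a gain. -/
theorem norm_sq_sub_smul_apply_le {A : H →L[ℂ] H} (hA : A.IsPositive) {M : ℝ} (hM0 : 0 < M)
    (hM : ‖A‖ ≤ M) (φ : H) :
    ‖φ - (M⁻¹ : ℂ) • A φ‖ ^ 2 ≤ ‖φ‖ ^ 2 - (‖A φ‖ / M) ^ 2 := by
  have h := norm_sq_apply_le_of_isPositive hA hM φ
  have h2 := @norm_sub_sq ℂ H _ _ _ φ ((M⁻¹ : ℂ) • A φ)
  rw [h2, inner_smul_right, norm_smul]
  have h3 : RCLike.re ((M⁻¹ : ℂ) * ⟪φ, A φ⟫_ℂ) = M⁻¹ * (⟪φ, A φ⟫_ℂ).re := by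
    rw [← Complex.ofReal_inv]
    simp
  rw [h3, norm_inv, Complex.norm_real, Real.norm_of_nonneg hM0.le]
  have h4 : (‖A φ‖ / M) ^ 2 ≤ M⁻¹ * (⟪φ, A φ⟫_ℂ).re := by
    rw [div_pow, div_le_iff₀ (by positivity)]
    calc _ ≤ _ := h
      _ = _ := by field_simp
  have h5 : (M⁻¹ * ‖A φ‖) ^ 2 = (‖A φ‖ / M) ^ 2 := by ring
  rw [h5]
  linarith

end Positive

/-! ### Displacements, phases and cutoffs of the weight -/

theorem displacement_norm (a : ℝ) (φ : WeightSpace) : ‖displacement a φ‖ = ‖φ‖ :=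
  LinearIsometry.norm_map (MeasureTheory.Lp.compMeasurePreservingₗᵢ ℂ (fun E : ℝ => E - a)
    (MeasureTheory.measurePreserving_sub_right MeasureTheory.volume a)) φ

theorem displacement_inner (a : ℝ) (φ ψ : WeightSpace) :
    ⟪displacement a φ, displacement a ψ⟫_ℂ = ⟪φ, ψ⟫_ℂ :=
  LinearIsometry.inner_map_map (MeasureTheory.Lp.compMeasurePreservingₗᵢ ℂ (fun E : ℝ => E - a)
    (MeasureTheory.measurePreserving_sub_right MeasureTheory.volume a)) φ ψ

theorem displacement_zero : displacement 0 = 1 := by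
  ext1 φ
  apply Lp.ext
  filter_upwards [displacement_apply 0 φ] with E h
  simpa using h

theorem displacement_add (a b : ℝ) : displacement (a + b) = displacement a * displacement b := by
  ext1 φ
  apply Lp.ext
  have hb := (measurePreserving_sub_right volume a).quasiMeasurePreserving.ae
    (displacement_apply b φ)
  filter_upwards [displacement_apply (a + b) φ, displacement_apply a (displacement b φ), hb]
    with E h1 h2 h3
  rw [h1, mul_apply_eq_comp, h2, h3, sub_sub]

theorem weightPhase_zero : weightPhase 0 = 1 := by
  ext1 φ
  apply Lp.ext
  filter_upwards [weightPhase_apply 0 φ] with E h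
  simpa using h

theorem weightPhase_add (s t : ℝ) : weightPhase (s + t) = weightPhase s * weightPhase t := by
  ext1 φ
  apply Lp.ext
  filter_upwards [weightPhase_apply (s + t) φ, weightPhase_apply s (weightPhase t φ),
    weightPhase_apply t φ] with E h1 h2 h3
  rw [h1, mul_apply_eq_comp, h2, h3, ← mul_assoc, ← Complex.exp_add]
  congr 2
  push_cast
  ring

theorem weightPhase_norm (s : ℝ) (φ : WeightSpace) : ‖weightPhase s φ‖ = ‖φ‖ := by
  rw [Lp.norm_def, Lp.norm_def]
  congr 1
  apply eLpNorm_congr_norm_ae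
  filter_upwards [weightPhase_apply s φ] with E h
  rw [h, norm_mul, Complex.norm_exp]
  simp

theorem weightPhase_mul_displacement (s a : ℝ) :
    weightPhase s * displacement a
      = Complex.exp (Complex.I * s * a) • (displacement a * weightPhase s) := by
  ext1 φ
  apply Lp.ext
  have hb := (measurePreserving_sub_right volume a).quasiMeasurePreserving.ae
    (weightPhase_apply s φ)
  filter_upwards [weightPhase_apply s (displacement a φ), displacement_apply a φ,
    displacement_apply a (weightPhase s φ), hb,
    Lp.coeFn_smul (Complex.exp (Complex.I * s * a)) (displacement a (weightPhase s φ))]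
    with E h1 h2 h3 h4 h5
  rw [mul_apply_eq_comp, h1, h2]
  change _ = (Complex.exp (Complex.I * s * a) • displacement a (weightPhase s φ) : WeightSpace) E
  rw [h5, Pi.smul_apply, h3, h4, smul_eq_mul, ← mul_assoc, ← Complex.exp_add]
  congr 2
  push_cast
  ring

theorem memLp_indicator_one {S : Set ℝ} (hS : MeasurableSet S) :
    MemLp (S.indicator fun _ => (1 : ℂ)) ∞ (volume : Measure ℝ) := by
  refine memLp_top_of_bound ((measurable_const.indicator hS).aestronglyMeasurable) 1
    (Filter.Eventually.of_forall fun E => ?_)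
  by_cases h : E ∈ S <;> simp [h]

/-- The spectral projection `1_S(H_W)`. -/
def cutoff {S : Set ℝ} (hS : MeasurableSet S) : WeightSpace →L[ℂ] WeightSpace :=
  (ContinuousLinearMap.lsmul ℂ ℂ).holderL volume ∞ 2 2 (memLp_indicator_one hS).toLp

theorem cutoff_apply {S : Set ℝ} (hS : MeasurableSet S) (φ : WeightSpace) :
    cutoff hS φ =ᵐ[volume] S.indicator φ := by
  have h1 := (ContinuousLinearMap.lsmul ℂ ℂ).coeFn_holder (r := 2) (memLp_indicator_one hS).toLp φ
  filter_upwards [h1, (memLp_indicator_one hS).coeFn_toLp] with E h1 h2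
  refine h1.trans ?_
  rw [h2]
  by_cases h : E ∈ S <;> simp [h]

theorem cutoff_adjoint {S : Set ℝ} (hS : MeasurableSet S) :
    ContinuousLinearMap.adjoint (cutoff hS) = cutoff hS := by
  symm
  rw [ContinuousLinearMap.eq_adjoint_iff]
  intro φ ψ
  rw [L2.inner_def, L2.inner_def]
  apply integral_congr_ae
  filter_upwards [cutoff_apply hS φ, cutoff_apply hS ψ] with E h1 h2
  rw [h1, h2]
  by_cases h : E ∈ S <;> simp [h]

theorem enorm_sq_eq_lintegral (φ : WeightSpace) : ‖φ‖ₑ ^ 2 = ∫⁻ E, ‖φ E‖ₑ ^ 2 := by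
  rw [Lp.enorm_def, eLpNorm_eq_lintegral_rpow_enorm_toReal (by norm_num) (by norm_num)]
  rw [← ENNReal.rpow_natCast, ← ENNReal.rpow_mul]
  norm_num

theorem enorm_sq_cutoff {S : Set ℝ} (hS : MeasurableSet S) (φ : WeightSpace) :
    ‖cutoff hS φ‖ₑ ^ 2 = ∫⁻ E in S, ‖φ E‖ₑ ^ 2 := by
  rw [enorm_sq_eq_lintegral, ← lintegral_indicator hS]
  apply lintegral_congr_ae
  filter_upwards [cutoff_apply hS φ] with E h
  rw [h]
  by_cases h : E ∈ S <;> simp [h]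

theorem norm_cutoff_le {S : Set ℝ} (hS : MeasurableSet S) (φ : WeightSpace) :
    ‖cutoff hS φ‖ ≤ ‖φ‖ := by
  apply Lp.norm_le_norm_of_ae_le
  filter_upwards [cutoff_apply hS φ] with E h
  rw [h]
  by_cases h : E ∈ S <;> simp [h]

/-- A phase acts almost as a scalar on vectors that are concentrated in energy. -/
theorem norm_weightPhase_sub_le (s m : ℝ) {L : ℝ} (hL : 0 ≤ L) (φ : WeightSpace) :
    ‖weightPhase s φ - Complex.exp (Complex.I * s * m) • φ‖
      ≤ |s| * L * ‖φ‖
        + 2 * ‖cutoff (measurableSet_closedBall (x := m) (ε := L)).compl φ‖ := by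
  set B := measurableSet_closedBall (x := m) (ε := L)
  set ψ := weightPhase s φ - Complex.exp (Complex.I * s * m) • φ with hψ
  have hval : ∀ᵐ E : ℝ, ψ E
      = Complex.exp (Complex.I * s * E) * φ E - Complex.exp (Complex.I * s * m) * φ E := by
    filter_upwards [Lp.coeFn_sub (weightPhase s φ) (Complex.exp (Complex.I * s * m) • φ),
      weightPhase_apply s φ, Lp.coeFn_smul (Complex.exp (Complex.I * s * m)) φ] with E h1 h2 h3
    rw [hψ, h1, Pi.sub_apply, h2, h3, Pi.smul_apply, smul_eq_mul]
  -- Inside the ball the two phases differ by at most |s| L, outside by at most 2.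
  have hsplit : ψ = cutoff B ψ + cutoff B.compl ψ := by
    apply Lp.ext
    filter_upwards [cutoff_apply B ψ, cutoff_apply B.compl ψ,
      Lp.coeFn_add (cutoff B ψ) (cutoff B.compl ψ)] with E h1 h2 h3
    rw [h3, Pi.add_apply, h1, h2]
    by_cases h : E ∈ Metric.closedBall m L <;> simp [h]
  have hin : ‖cutoff B ψ‖ ≤ |s| * L * ‖φ‖ := by
    apply Lp.norm_le_mul_norm_of_ae_le_mul
    filter_upwards [cutoff_apply B ψ, hval] with E h1 h2
    rw [h1]
    by_cases h : E ∈ Metric.closedBall m L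
    · rw [Set.indicator_of_mem h, h2, ← sub_mul, norm_mul]
      gcongr
      have h3 : Complex.exp (Complex.I * s * E) - Complex.exp (Complex.I * s * m)
          = Complex.exp (Complex.I * s * m)
            * (Complex.exp (Complex.I * ((s * (E - m) : ℝ) : ℂ)) - 1) := by
        rw [mul_sub, ← Complex.exp_add, mul_one]
        congr 2
        push_cast
        ring
      have h4 : ‖Complex.exp (Complex.I * s * m)‖ = 1 := by simp [Complex.norm_exp]
      rw [h3, norm_mul, h4, one_mul]
      refine Real.norm_exp_I_mul_ofReal_sub_one_le.trans ?_
      rw [norm_mul]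
      exact mul_le_mul_of_nonneg_left (by simpa [Real.dist_eq] using h) (norm_nonneg _)
    · rw [Set.indicator_of_notMem h, norm_zero]
      positivity
  have hout : ‖cutoff B.compl ψ‖ ≤ 2 * ‖cutoff B.compl φ‖ := by
    apply Lp.norm_le_mul_norm_of_ae_le_mul
    filter_upwards [cutoff_apply B.compl ψ, cutoff_apply B.compl φ, hval] with E h1 h2 h3
    rw [h1, h2]
    by_cases h : E ∈ Metric.closedBall m L
    · simp [h]
    · rw [Set.indicator_of_mem (by exact h), Set.indicator_of_mem (by exact h), h3]
      refine (norm_sub_le _ _).trans (le_of_eq ?_)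
      have h4 : ∀ x : ℝ, ‖Complex.exp (Complex.I * s * x)‖ = 1 := by simp [Complex.norm_exp]
      rw [norm_mul, norm_mul, h4, h4]
      ring
  rw [hsplit]
  exact (norm_add_le _ _).trans (add_le_add hin hout)

/-! ### Combinations of displacements -/

/-- The algebra homomorphism that sends a formal combination `∑ a, c a • [a]` to the operator
`∑ a, c a • Γ_a`. -/
def displacementHom : AddMonoidAlgebra ℂ ℝ →ₐ[ℂ] (WeightSpace →L[ℂ] WeightSpace) :=
  AddMonoidAlgebra.lift ℂ (WeightSpace →L[ℂ] WeightSpace) ℝ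
    { toFun := fun a => displacement a.toAdd
      map_one' := by simp [displacement_zero]
      map_mul' := fun a b => by simp [displacement_add] }

@[simp]
theorem displacementHom_single (a : ℝ) (c : ℂ) :
    displacementHom (AddMonoidAlgebra.single a c) = c • displacement a := by
  simp [displacementHom]

/-- The automorphism `[a] ↦ exp(-i s a) [a]`, implemented by the phase `exp(i s H_W)`. -/
def modulate (s : ℝ) : AddMonoidAlgebra ℂ ℝ →ₐ[ℂ] AddMonoidAlgebra ℂ ℝ :=
  AddMonoidAlgebra.lift ℂ (AddMonoidAlgebra ℂ ℝ) ℝ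
    { toFun := fun a => AddMonoidAlgebra.single a.toAdd (Complex.exp (-(Complex.I * s * a.toAdd)))
      map_one' := by simp [AddMonoidAlgebra.one_def]
      map_mul' := fun a b => by
        rw [AddMonoidAlgebra.single_mul_single, ← Complex.exp_add]
        congr 2
        push_cast [toAdd_mul]
        ring }

@[simp]
theorem modulate_single (s a : ℝ) (c : ℂ) :
    modulate s (AddMonoidAlgebra.single a c)
      = AddMonoidAlgebra.single a (c * Complex.exp (-(Complex.I * s * a))) := by
  simp [modulate]

theorem weightPhase_neg_mul_self (s : ℝ) : weightPhase (-s) * weightPhase s = 1 := by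
  rw [← weightPhase_add, neg_add_cancel, weightPhase_zero]

theorem weightPhase_conj_pow (s : ℝ) (A : WeightSpace →L[ℂ] WeightSpace) (J : ℕ) :
    (weightPhase (-s) * A * weightPhase s) ^ J = weightPhase (-s) * A ^ J * weightPhase s := by
  induction J with
  | zero => simp [weightPhase_neg_mul_self]
  | succ J ih =>
    have h : weightPhase s * weightPhase (-s) = 1 := by
      simpa using weightPhase_neg_mul_self (-s)
    rw [pow_succ, ih, pow_succ]
    calc _ = weightPhase (-s) * A ^ J * (weightPhase s * weightPhase (-s)) * A * weightPhase s := by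
          simp only [mul_assoc]
      _ = _ := by rw [h, mul_one, mul_assoc (weightPhase (-s))]

/-- The Weyl relation, checked on generators: conjugation by a phase acts on coefficients only, so
all conjugates stay in one commutative algebra. -/
theorem displacementHom_modulate (s : ℝ) (x : AddMonoidAlgebra ℂ ℝ) :
    displacementHom (modulate s x) = weightPhase (-s) * displacementHom x * weightPhase s := by
  induction x using AddMonoidAlgebra.induction_linear with
  | zero => simp
  | add x y hx hy => simp [hx, hy, mul_add, add_mul]
  | single a c =>
    rw [modulate_single, displacementHom_single, displacementHom_single, mul_smul_comm,
      weightPhase_mul_displacement, smul_mul_assoc, smul_mul_assoc, mul_assoc (displacement a),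
      weightPhase_neg_mul_self, mul_one, smul_smul]
    congr 3
    push_cast
    ring

theorem eq_sum_single_of_support_subset {Ω : Finset ℝ} {x : AddMonoidAlgebra ℂ ℝ}
    (hx : x.coeff.support ⊆ Ω) : x = ∑ a ∈ Ω, AddMonoidAlgebra.single a (x.coeff a) := by
  conv_lhs => rw [← AddMonoidAlgebra.sum_coeff_single x]
  exact Finsupp.sum_of_support_subset _ hx _ (by simp)

/-- The zeroth coefficient of a combination of displacements is recovered by Lagrange
interpolation from equidistant modulations. -/
theorem sum_lagrange_smul_modulate {Ω : Finset ℝ} (h0 : 0 ∈ Ω) {x : AddMonoidAlgebra ℂ ℝ}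
    (hx : x.coeff.support ⊆ Ω) {τ : ℝ}
    (hτ : Set.InjOn (fun a : ℝ => Complex.exp (-(Complex.I * τ * a))) Ω) :
    ∑ i ∈ Finset.range Ω.card,
        (Lagrange.basis Ω (fun a : ℝ => Complex.exp (-(Complex.I * τ * a))) 0).coeff i
          • modulate (i * τ) x
      = AddMonoidAlgebra.single 0 (x.coeff 0) := by
  set p := Lagrange.basis Ω (fun a : ℝ => Complex.exp (-(Complex.I * τ * a))) 0 with hp
  have hdeg : p.natDegree < Ω.card := by
    rw [hp, Polynomial.natDegree_lt_iff_degree_lt (Lagrange.basis_ne_zero hτ h0),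
      Lagrange.degree_basis hτ h0]
    exact_mod_cast Nat.sub_lt (Finset.card_pos.2 ⟨0, h0⟩) one_pos
  -- Modulation by `i * τ` multiplies the coefficient at `a` by the `i`-th power of the node
  -- exp(-iτa). The sum therefore evaluates the Lagrange polynomial at that node, which gives 1 for
  -- a = 0 and 0 for the other elements of `Ω`.
  have heval : ∀ a : ℝ, ∑ i ∈ Finset.range Ω.card,
      p.coeff i * (x.coeff a * Complex.exp (-(Complex.I * (i * τ : ℝ) * a)))
        = x.coeff a * p.eval (Complex.exp (-(Complex.I * τ * a))) := by
    intro a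
    rw [Polynomial.eval_eq_sum_range' hdeg, Finset.mul_sum]
    refine Finset.sum_congr rfl fun i _ => ?_
    rw [← Complex.exp_nat_mul]
    have : -(Complex.I * ((i * τ : ℝ) : ℂ) * a) = (i : ℂ) * -(Complex.I * τ * a) := by
      push_cast
      ring
    rw [this]
    ring
  conv_lhs => rw [eq_sum_single_of_support_subset hx]
  simp only [map_sum, modulate_single, Finset.smul_sum]
  rw [Finset.sum_comm]
  have h1 : ∀ a ∈ Ω, ∑ i ∈ Finset.range Ω.card, p.coeff i • AddMonoidAlgebra.single a
      (x.coeff a * Complex.exp (-(Complex.I * (i * τ : ℝ) * a)))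
        = if a = 0 then AddMonoidAlgebra.single 0 (x.coeff 0) else 0 := by
    intro a ha
    simp only [AddMonoidAlgebra.smul_single, smul_eq_mul]
    simp only [← AddMonoidAlgebra.singleAddHom_apply]
    rw [← map_sum, heval]
    simp only [AddMonoidAlgebra.singleAddHom_apply]
    split_ifs with h
    · subst h
      rw [hp, Lagrange.eval_basis_self hτ h0, mul_one]
    · rw [hp, Lagrange.eval_basis_of_ne (v := fun a : ℝ => Complex.exp (-(Complex.I * τ * a)))
        (Ne.symm h) ha, mul_zero, AddMonoidAlgebra.single_zero]
  rw [Finset.sum_congr rfl h1]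
  simp [h0]

/-- The interpolation identity applied to φ, followed by Cauchy–Schwarz: the phase conjugates of the
operator cannot all be small on the same vector. -/
theorem norm_coeff_sq_mul_le {Ω : Finset ℝ} (h0 : 0 ∈ Ω) {x : AddMonoidAlgebra ℂ ℝ}
    (hx : x.coeff.support ⊆ Ω) {τ : ℝ}
    (hτ : Set.InjOn (fun a : ℝ => Complex.exp (-(Complex.I * τ * a))) Ω) (φ : WeightSpace) :
    ‖x.coeff 0‖ ^ 2 * ‖φ‖ ^ 2 ≤
      (∑ i ∈ Finset.range Ω.card,
        ‖(Lagrange.basis Ω (fun a : ℝ => Complex.exp (-(Complex.I * τ * a))) 0).coeff i‖ ^ 2)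
      * ∑ i ∈ Finset.range Ω.card, ‖displacementHom x (weightPhase (i * τ) φ)‖ ^ 2 := by
  have h1 := congrArg displacementHom (sum_lagrange_smul_modulate h0 hx hτ)
  set p := Lagrange.basis Ω (fun a : ℝ => Complex.exp (-(Complex.I * τ * a))) 0
  rw [displacementHom_single, displacement_zero, map_sum] at h1
  have h2 : x.coeff 0 • φ = ∑ i ∈ Finset.range Ω.card,
      p.coeff i • weightPhase (-(i * τ)) (displacementHom x (weightPhase (i * τ) φ)) := by
    have := congrArg (fun T : WeightSpace →L[ℂ] WeightSpace => T φ) h1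
    simp only [map_smul, displacementHom_modulate, sum_apply,
      smul_apply, mul_apply_eq_comp] at this
    exact this.symm
  have h3 : ‖x.coeff 0‖ * ‖φ‖ ≤ ∑ i ∈ Finset.range Ω.card,
      ‖p.coeff i‖ * ‖displacementHom x (weightPhase (i * τ) φ)‖ := by
    rw [← norm_smul, h2]
    refine (norm_sum_le _ _).trans (le_of_eq ?_)
    simp only [norm_smul, weightPhase_norm]
  rw [← mul_pow]
  exact (pow_le_pow_left₀ (by positivity) h3 2).trans (Finset.sum_mul_sq_le_sq_mul_sq _ _ _)

theorem injOn_exp_neg_I_mul {Ω : Finset ℝ} {τ : ℝ} (hτ0 : 0 < τ) (hτ : ∀ a ∈ Ω, τ * |a| ≤ 1) :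
    Set.InjOn (fun a : ℝ => Complex.exp (-(Complex.I * τ * a))) Ω := by
  intro a ha b hb hab
  have him : ∀ c : ℝ, (-(Complex.I * τ * c)).im = -(τ * c) := by intro c; simp
  have hbd : ∀ c ∈ Ω, |τ * c| ≤ 1 := fun c hc => by
    rw [abs_mul, abs_of_pos hτ0]; exact hτ c hc
  have ha' := abs_le.1 (hbd a ha)
  have hb' := abs_le.1 (hbd b hb)
  have hpi := Real.pi_gt_three
  have h := Complex.exp_inj_of_neg_pi_lt_of_le_pi (by rw [him]; linarith) (by rw [him]; linarith)
    (by rw [him]; linarith) (by rw [him]; linarith) hab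
  have h2 := congrArg Complex.im h
  rw [him, him, neg_inj] at h2
  exact mul_left_cancel₀ hτ0.ne' h2

set_option maxHeartbeats 1000000 in
/-- A positive combination `X` of displacements with a non-zero zeroth coefficient is bounded below
on vectors that are concentrated in an energy interval of a given length. The weight of the part
outside of the interval does not depend on the length. -/
theorem norm_sq_le_inner_add_cutoff {Ω : Finset ℝ} (h0 : 0 ∈ Ω) {c₀ M : ℝ} (hc₀ : 0 < c₀)
    (hM0 : 0 < M) {L : ℝ} (hL : 0 ≤ L) :
    ∃ C : ℝ, 0 < C ∧ ∀ x : AddMonoidAlgebra ℂ ℝ, x.coeff.support ⊆ Ω → c₀ ≤ ‖x.coeff 0‖ →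
      (displacementHom x).IsPositive → ‖displacementHom x‖ ≤ M → ∀ (m : ℝ) (φ : WeightSpace),
      ‖φ‖ ^ 2 ≤ C * (⟪φ, displacementHom x φ⟫_ℂ).re
        + 128 * Ω.card ^ 2
          * ‖cutoff (measurableSet_closedBall (x := m) (ε := L)).compl φ‖ ^ 2 := by
  set d : ℝ := (Ω.card : ℝ) with hd
  have hd0 : 0 < d := Nat.cast_pos.2 <| Finset.card_pos.2 ⟨0, h0⟩
  -- The sum over `Ω` gives τ|a| ≤ 1 < π, so the interpolation nodes are distinct. The term 8 d² L
  -- makes the phases with s = iτ, i < d, nearly scalar on an interval of radius `L`.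
  set τ : ℝ := 1 / (1 + ∑ a ∈ Ω, |a| + 8 * d ^ 2 * L) with hτdef
  have hS0 : 0 ≤ ∑ a ∈ Ω, |a| := Finset.sum_nonneg fun _ _ => abs_nonneg _
  have hτ0 : 0 < τ := by positivity
  have hτL : 8 * d ^ 2 * τ * L ≤ 1 := by
    rw [hτdef, mul_one_div, div_mul_eq_mul_div, div_le_one (by positivity)]
    linarith
  have hinj : Set.InjOn (fun a : ℝ => Complex.exp (-(Complex.I * τ * a))) Ω := by
    refine injOn_exp_neg_I_mul hτ0 fun a ha => ?_
    rw [hτdef, one_div_mul_eq_div, div_le_one (by positivity)]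
    have := Finset.single_le_sum (f := fun a : ℝ => |a|) (fun _ _ => abs_nonneg _) ha
    have h2 : 0 ≤ 8 * d ^ 2 * L := by positivity
    linarith
  set N := ∑ i ∈ Finset.range Ω.card,
    ‖(Lagrange.basis Ω (fun a : ℝ => Complex.exp (-(Complex.I * τ * a))) 0).coeff i‖ ^ 2 with hN
  have hN0 : 0 ≤ N := Finset.sum_nonneg fun _ _ => by positivity
  -- Chosen so that `κ ≤ 1` and d κ (N + 1) M² ≤ c₀²: the mean of the squared norms of the `d`
  -- contractions on a vector then drops by the factor 1 - κ.
  set κ : ℝ := c₀ ^ 2 / (d * (N + 1) * M ^ 2 + c₀ ^ 2) with hκ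
  have hκ0 : 0 < κ := by positivity
  have hκ1 : κ ≤ 1 := by
    rw [hκ, div_le_one (by positivity)]
    have : 0 ≤ d * (N + 1) * M ^ 2 := by positivity
    linarith
  have hκ2 : d * κ * (N + 1) * M ^ 2 ≤ c₀ ^ 2 := by
    rw [hκ, mul_div_assoc', div_mul_eq_mul_div, div_mul_eq_mul_div, div_le_iff₀ (by positivity)]
    nlinarith [sq_nonneg (c₀ ^ 2)]
  have hθ1 : √(1 - κ) < 1 := by
    rw [Real.sqrt_lt' one_pos]
    linarith
  obtain ⟨J, hJ⟩ := exists_pow_lt_of_lt_one (by norm_num : (0 : ℝ) < 1 / 4) hθ1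
  -- The constant that results from squaring the final estimate; `J ^ 2 + 1` keeps it positive when
  -- `J = 0`.
  refine ⟨8 * d ^ 2 * (J ^ 2 + 1) / M, by positivity, ?_⟩
  intro x hx hxc hpos hxM m φ
  set X := displacementHom x with hX
  set P := cutoff (measurableSet_closedBall (x := m) (ε := L)).compl φ
  set A : WeightSpace →L[ℂ] WeightSpace := 1 - (M⁻¹ : ℂ) • X with hA
  have hAapply : ∀ ψ, A ψ = ψ - (M⁻¹ : ℂ) • X ψ := fun ψ => rfl
  have hAnorm : ∀ ψ, ‖A ψ‖ ^ 2 ≤ ‖ψ‖ ^ 2 - (‖X ψ‖ / M) ^ 2 := fun ψ => by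
    rw [hAapply]
    exact norm_sq_sub_smul_apply_le hpos hM0 hxM ψ
  have hAcontr : ∀ ψ, ‖A ψ‖ ≤ ‖ψ‖ := fun ψ => by
    refine le_of_sq_le_sq ((hAnorm ψ).trans ?_) (norm_nonneg _)
    linarith [sq_nonneg (‖X ψ‖ / M)]
  -- The conjugates of `A` are built in the commutative group algebra, so they commute without
  -- further argument.
  set a : ℕ → AddMonoidAlgebra ℂ ℝ :=
    fun i => modulate (i * τ) (1 - AddMonoidAlgebra.single 0 (M⁻¹ : ℂ) * x) with ha
  have hπa : ∀ i, displacementHom (a i)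
      = weightPhase (-(i * τ)) * A * weightPhase (i * τ) := by
    intro i
    rw [ha, displacementHom_modulate, map_sub, map_one, map_mul, displacementHom_single,
      displacement_zero, smul_mul_assoc, one_mul]
  have hcontr : ∀ i ψ, ‖displacementHom (a i) ψ‖ ≤ ‖ψ‖ := by
    intro i ψ
    rw [hπa, mul_apply_eq_comp, mul_apply_eq_comp, weightPhase_norm]
    exact (hAcontr _).trans (weightPhase_norm _ _).le
  have hpow : ∀ i, displacementHom (a i) ^ J
      = weightPhase (-(i * τ)) * A ^ J * weightPhase (i * τ) :=
    fun i => by rw [hπa, weightPhase_conj_pow]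
  have hsum : ∀ ψ, ∑ i ∈ Finset.range Ω.card, ‖displacementHom (a i) ψ‖ ^ 2
      ≤ (Finset.range Ω.card).card * ((1 - κ) * ‖ψ‖ ^ 2) := by
    intro ψ
    rw [Finset.card_range, ← hd]
    have h1 : ∀ i ∈ Finset.range Ω.card, ‖displacementHom (a i) ψ‖ ^ 2
        ≤ ‖ψ‖ ^ 2 - ‖X (weightPhase (i * τ) ψ)‖ ^ 2 / M ^ 2 := by
      intro i _
      rw [hπa, mul_apply_eq_comp, mul_apply_eq_comp, weightPhase_norm, ← div_pow]
      exact (hAnorm _).trans_eq (by rw [weightPhase_norm])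
    refine (Finset.sum_le_sum h1).trans ?_
    rw [Finset.sum_sub_distrib, Finset.sum_const, Finset.card_range, nsmul_eq_mul, ← hd,
      ← Finset.sum_div]
    have h2 := norm_coeff_sq_mul_le h0 hx hinj ψ
    rw [← hN] at h2
    set S := ∑ i ∈ Finset.range Ω.card, ‖displacementHom x (weightPhase (i * τ) ψ)‖ ^ 2 with hS
    have hS0 : 0 ≤ S := Finset.sum_nonneg fun _ _ => by positivity
    have h3 : c₀ ^ 2 * ‖ψ‖ ^ 2 ≤ (N + 1) * S := by
      have h4 : c₀ ^ 2 * ‖ψ‖ ^ 2 ≤ ‖x.coeff 0‖ ^ 2 * ‖ψ‖ ^ 2 := by gcongr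
      linarith
    have h5 : d * κ * ‖ψ‖ ^ 2 ≤ S / M ^ 2 := by
      rw [le_div_iff₀ (by positivity)]
      have h6 : d * κ * (N + 1) * M ^ 2 * ‖ψ‖ ^ 2 ≤ c₀ ^ 2 * ‖ψ‖ ^ 2 := by gcongr
      refine le_of_mul_le_mul_left (a := N + 1) ?_ (by positivity)
      linarith
    linarith
  have hmain := norm_le_of_commuting_contractions displacementHom.toRingHom a hcontr
    (Finset.range Ω.card) (Finset.nonempty_range_iff.2 (Finset.card_ne_zero_of_mem h0)) (1 - κ)
    (by linarith) hsum J φ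
  have hterm : ∀ i ∈ Finset.range Ω.card, ‖φ - (displacementHom (a i) ^ J) φ‖
      ≤ J * ‖X φ‖ / M + (d * τ * L * 2 * ‖φ‖ + 4 * ‖P‖) := by
    intro i hi
    have hid : (i : ℝ) ≤ d := Nat.cast_le.2 (Finset.mem_range.1 hi).le
    set ψ := weightPhase (i * τ) φ with hψ
    set c := Complex.exp (Complex.I * (i * τ : ℝ) * m) with hc
    have hc1 : ‖c‖ = 1 := by rw [hc, Complex.norm_exp]; simp
    have h1 : ‖φ - (displacementHom (a i) ^ J) φ‖ = ‖ψ - (A ^ J) ψ‖ := by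
      have h : weightPhase (-(i * τ)) ψ = φ := by
        rw [hψ, ← mul_apply_eq_comp, weightPhase_neg_mul_self, one_apply_eq_self]
      rw [hpow, ← weightPhase_norm (-(i * τ)) (ψ - _), map_sub, h]
      rfl
    have h2 : ‖ψ - c • φ‖ ≤ d * τ * L * ‖φ‖ + 2 * ‖P‖ := by
      refine (norm_weightPhase_sub_le _ m hL φ).trans ?_
      rw [abs_of_nonneg (by positivity)]
      gcongr
    -- The phase is traded for the scalar `c` before `A ^ J` acts. As `A ^ J` is a contraction, the
    -- error is at most 2‖ψ - cφ‖ whatever `J` is; this keeps the tail constant independent of `L`.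
    have h3 : ψ - (A ^ J) ψ = c • (φ - (A ^ J) φ) + ((ψ - c • φ) - (A ^ J) (ψ - c • φ)) := by
      rw [map_sub, map_smul, smul_sub]
      abel
    have h4 : ‖φ - (A ^ J) φ‖ ≤ J * ‖X φ‖ / M := by
      refine (norm_sub_pow_apply_le A hAcontr J φ).trans (le_of_eq ?_)
      rw [hAapply, sub_sub_cancel, norm_smul, norm_inv, Complex.norm_real,
        Real.norm_of_nonneg hM0.le]
      ring
    have h5 : ∀ ψ, ‖(A ^ J) ψ‖ ≤ ‖ψ‖ := fun ψ => by
      simpa using norm_pow_apply_le A 1 zero_le_one (by simpa using hAcontr) J ψ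
    rw [h1, h3]
    calc _ ≤ ‖c • (φ - (A ^ J) φ)‖ + (‖ψ - c • φ‖ + ‖(A ^ J) (ψ - c • φ)‖) :=
          (norm_add_le _ _).trans (by gcongr; exact norm_sub_le _ _)
      _ ≤ J * ‖X φ‖ / M + (‖ψ - c • φ‖ + ‖ψ - c • φ‖) := by
          rw [norm_smul, hc1, one_mul]
          gcongr
          exact h5 _
      _ ≤ _ := by linarith
  have hmain2 := hmain.trans (add_le_add (mul_le_mul_of_nonneg_right hJ.le (norm_nonneg φ))
    (Finset.sum_le_sum hterm))
  rw [Finset.sum_const, Finset.card_range, nsmul_eq_mul, ← hd] at hmain2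
  have h7 : d * (d * τ * L * 2 * ‖φ‖) ≤ 1 / 4 * ‖φ‖ := by
    have := mul_le_mul_of_nonneg_right hτL (norm_nonneg φ)
    linarith
  -- One quarter of ‖φ‖ from the strict contraction and one quarter from the phase error are
  -- absorbed on the left.
  have h8 : ‖φ‖ ≤ 2 * d * J * (‖X φ‖ / M) + 8 * d * ‖P‖ := by
    have h9 : d * (J * ‖X φ‖ / M + (d * τ * L * 2 * ‖φ‖ + 4 * ‖P‖))
      = d * J * (‖X φ‖ / M) + d * (d * τ * L * 2 * ‖φ‖) + 4 * d * ‖P‖ := by ring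
    linarith
  have h10 := norm_sq_apply_le_of_isPositive hpos hxM φ
  have h11 : (‖X φ‖ / M) ^ 2 ≤ (⟪φ, X φ⟫_ℂ).re / M := by
    rw [div_pow, div_le_div_iff₀ (by positivity) hM0]
    nlinarith
  calc ‖φ‖ ^ 2 ≤ (2 * d * J * (‖X φ‖ / M) + 8 * d * ‖P‖) ^ 2 := by gcongr
    _ ≤ 2 * (2 * d * J * (‖X φ‖ / M)) ^ 2 + 2 * (8 * d * ‖P‖) ^ 2 := by
      nlinarith [sq_nonneg (2 * d * J * (‖X φ‖ / M) - 8 * d * ‖P‖)]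
    _ = 8 * d ^ 2 * J ^ 2 * (‖X φ‖ / M) ^ 2 + 128 * d ^ 2 * ‖P‖ ^ 2 := by ring
    _ ≤ 8 * d ^ 2 * (J ^ 2 + 1) * ((⟪φ, X φ⟫_ℂ).re / M) + 128 * d ^ 2 * ‖P‖ ^ 2 := by
      gcongr
      linarith
    _ = _ := by ring

/-! ### Hilbert–Schmidt sums -/

/-- The squared Hilbert–Schmidt norm `∑ k, ‖A b k‖²`. -/
def hilbertSchmidtSq (A : WeightSpace →L[ℂ] WeightSpace) : ℝ≥0∞ :=
  ∑' k, ‖A (weightBasis k)‖ₑ ^ 2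

theorem enorm_sq_eq_ofReal {V : Type*} [NormedAddCommGroup V] (v : V) :
    ‖v‖ₑ ^ 2 = ENNReal.ofReal (‖v‖ ^ 2) := by
  rw [ENNReal.ofReal_pow (norm_nonneg _), ofReal_norm]

theorem enorm_sq_eq_tsum_inner (x : WeightSpace) :
    ‖x‖ₑ ^ 2 = ∑' k, ‖⟪weightBasis k, x⟫_ℂ‖ₑ ^ 2 := by
  have h := weightBasis.hasSum_inner_mul_inner x x
  have h2 := Complex.hasSum_re h
  have h3 : ∀ k, (⟪x, weightBasis k⟫_ℂ * ⟪weightBasis k, x⟫_ℂ).re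
      = ‖⟪weightBasis k, x⟫_ℂ‖ ^ 2 := fun k => by
    rw [← inner_conj_symm x, mul_comm, Complex.mul_conj, Complex.normSq_eq_norm_sq]
    simp only [Complex.ofReal_re]
  have h4 : (⟪x, x⟫_ℂ).re = ‖x‖ ^ 2 := by
    rw [inner_self_eq_norm_sq_to_K]; norm_cast
  simp only [h3, h4] at h2
  simp only [enorm_sq_eq_ofReal]
  rw [← h2.tsum_eq, ENNReal.ofReal_tsum_of_nonneg (fun _ => by positivity) h2.summable]

/-- By Parseval both sides are the double sum of squared matrix entries, taken in the two orders. -/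
theorem hilbertSchmidtSq_adjoint (A : WeightSpace →L[ℂ] WeightSpace) :
    hilbertSchmidtSq (ContinuousLinearMap.adjoint A) = hilbertSchmidtSq A := by
  unfold hilbertSchmidtSq
  simp_rw [enorm_sq_eq_tsum_inner]
  rw [ENNReal.tsum_comm]
  refine tsum_congr fun k => tsum_congr fun l => ?_
  rw [ContinuousLinearMap.adjoint_inner_right, ← inner_conj_symm, RCLike.enorm_conj]

theorem hilbertSchmidtSq_le {A B : WeightSpace →L[ℂ] WeightSpace} (h : ∀ φ, ‖A φ‖ ≤ ‖B φ‖) :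
    hilbertSchmidtSq A ≤ hilbertSchmidtSq B :=
  ENNReal.tsum_le_tsum fun k => by
    gcongr
    exact enorm_le_iff_norm_le.2 (h _)

theorem hasSum_norm_sq {A : WeightSpace →L[ℂ] WeightSpace} (hA : hilbertSchmidtSq A ≠ ∞) :
    HasSum (fun k => ‖A (weightBasis k)‖ ^ 2) (hilbertSchmidtSq A).toReal := by
  have h := ENNReal.hasSum_toReal hA
  rw [← ENNReal.tsum_toReal_eq fun k => ENNReal.ne_top_of_tsum_ne_top hA k] at h
  simpa [hilbertSchmidtSq] using h

theorem hilbertSchmidtSq_add_ne_top {A B : WeightSpace →L[ℂ] WeightSpace}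
    (hA : hilbertSchmidtSq A ≠ ∞) (hB : hilbertSchmidtSq B ≠ ∞) :
    hilbertSchmidtSq (A + B) ≠ ∞ := by
  have h : hilbertSchmidtSq (A + B) ≤ 2 * (hilbertSchmidtSq A + hilbertSchmidtSq B) := by
    unfold hilbertSchmidtSq
    rw [← ENNReal.tsum_add, ← ENNReal.tsum_mul_left]
    refine ENNReal.tsum_le_tsum fun k => ?_
    refine (pow_le_pow_left' (enorm_add_le _ _) 2).trans ?_
    have := ENNReal.rpow_add_le_mul_rpow_add_rpow (‖A (weightBasis k)‖ₑ) (‖B (weightBasis k)‖ₑ)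
      (p := 2) (by norm_num)
    norm_num at this
    simpa using this
  refine ne_top_of_le_ne_top ?_ h
  finiteness

theorem hilbertSchmidtSq_smul (c : ℂ) (A : WeightSpace →L[ℂ] WeightSpace) :
    hilbertSchmidtSq (c • A) = ‖c‖ₑ ^ 2 * hilbertSchmidtSq A := by
  unfold hilbertSchmidtSq
  rw [← ENNReal.tsum_mul_left]
  refine tsum_congr fun k => ?_
  rw [smul_apply, enorm_smul, mul_pow]

/-- Cyclicity of the trace for a product of two Hilbert–Schmidt operators. -/
theorem tsum_inner_adjoint {A B : WeightSpace →L[ℂ] WeightSpace}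
    (hA : hilbertSchmidtSq A ≠ ∞) (hB : hilbertSchmidtSq B ≠ ∞) :
    (Summable fun k => ⟪B (weightBasis k), A (weightBasis k)⟫_ℂ) ∧
    ∑' k, ⟪ContinuousLinearMap.adjoint A (weightBasis k),
        ContinuousLinearMap.adjoint B (weightBasis k)⟫_ℂ
      = ∑' k, ⟪B (weightBasis k), A (weightBasis k)⟫_ℂ := by
  have hsmul : ∀ (c : ℂ), hilbertSchmidtSq (c • B) ≠ ∞ := fun c => by
    rw [hilbertSchmidtSq_smul]; finiteness
  have h1 := hilbertSchmidtSq_add_ne_top hA hB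
  have h2 := hilbertSchmidtSq_add_ne_top hA (hsmul (-1))
  have h3 := hilbertSchmidtSq_add_ne_top hA (hsmul Complex.I)
  have h4 := hilbertSchmidtSq_add_ne_top hA (hsmul (-Complex.I))
  have key : ∀ T : WeightSpace →L[ℂ] WeightSpace, hilbertSchmidtSq T ≠ ∞ →
      HasSum (fun k => ((‖T (weightBasis k)‖ : ℂ) ^ 2)) ((hilbertSchmidtSq T).toReal : ℂ) ∧
      HasSum (fun k => ((‖ContinuousLinearMap.adjoint T (weightBasis k)‖ : ℂ) ^ 2))
        ((hilbertSchmidtSq T).toReal : ℂ) := by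
    intro T hT
    have h5 := hasSum_norm_sq hT
    have h6 := hasSum_norm_sq (A := ContinuousLinearMap.adjoint T)
      (by rwa [hilbertSchmidtSq_adjoint])
    rw [hilbertSchmidtSq_adjoint] at h6
    exact ⟨by exact_mod_cast h5, by exact_mod_cast h6⟩
  -- Polarization of ‖T‖ = ‖T†‖ over T = A ± B, A ± iB. Adjunction conjugates ±i, so the same four
  -- norms yield the inner product with its arguments in the other order.
  have e1 := ((((key _ h1).1.sub (key _ h2).1).add
    (((key _ h3).1.sub (key _ h4).1).mul_right Complex.I)).div_const 4)
  have e2 := ((((key _ h1).2.sub (key _ h2).2).add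
    (((key _ h3).2.sub (key _ h4).2).mul_right Complex.I)).div_const 4)
  have g1 : ∀ x y : WeightSpace, ((‖x + y‖ : ℂ) ^ 2 - (‖x + (-1 : ℂ) • y‖ : ℂ) ^ 2
      + ((‖x + Complex.I • y‖ : ℂ) ^ 2 - (‖x + (-Complex.I) • y‖ : ℂ) ^ 2) * Complex.I) / 4
      = ⟪y, x⟫_ℂ := by
    intro x y
    have hn1 : ‖x + (-1 : ℂ) • y‖ = ‖y - x‖ := by
      rw [neg_one_smul, ← sub_eq_add_neg, norm_sub_rev]
    have hn2 : ‖x + Complex.I • y‖ = ‖y - Complex.I • x‖ := by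
      rw [← one_mul ‖y - _‖, ← Complex.norm_I, ← norm_smul, smul_sub, smul_smul, Complex.I_mul_I,
        neg_one_smul, sub_neg_eq_add, add_comm]
    have hn3 : ‖x + (-Complex.I) • y‖ = ‖y + Complex.I • x‖ := by
      rw [← one_mul ‖y + _‖, ← Complex.norm_I, ← norm_neg Complex.I, ← norm_smul, smul_add,
        smul_smul, neg_mul, Complex.I_mul_I, neg_neg, one_smul, add_comm]
    rw [inner_eq_sum_norm_sq_div_four y x, hn1, hn2, hn3, add_comm x y]
    simp
  have g2 : ∀ x y : WeightSpace, ((‖x + y‖ : ℂ) ^ 2 - (‖x + (-1 : ℂ) • y‖ : ℂ) ^ 2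
      + ((‖x + (-Complex.I) • y‖ : ℂ) ^ 2 - (‖x + Complex.I • y‖ : ℂ) ^ 2) * Complex.I) / 4
      = ⟪x, y⟫_ℂ := by
    intro x y
    rw [inner_eq_sum_norm_sq_div_four x y, neg_one_smul, neg_smul, ← sub_eq_add_neg,
      ← sub_eq_add_neg]
    simp
  simp only [map_add, LinearIsometryEquiv.map_smulₛₗ, add_apply, smul_apply,
    map_neg, map_one, Complex.conj_I, neg_neg, g1, g2]
    at e1 e2
  exact ⟨e1.summable, e2.tsum_eq.trans e1.tsum_eq.symm⟩

/-- Energy tails become Hilbert–Schmidt norms, which can be estimated vector by vector. -/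
theorem energyDistribution_apply (ρ : WeightSpace →L[ℂ] WeightSpace) {S : Set ℝ}
    (hS : MeasurableSet S) :
    energyDistribution ρ S = hilbertSchmidtSq (cutoff hS * operatorSqrt ρ) := by
  rw [energyDistribution, Measure.sum_apply _ hS]
  refine tsum_congr fun k => ?_
  rw [withDensity_apply _ hS, mul_apply_eq_comp, enorm_sq_cutoff]

/-- If `ρ = ∑ α, X α X α†`, then `‖T √ρ‖² = ∑ α, ‖T X α‖²` in Hilbert–Schmidt norm. -/
theorem hilbertSchmidtSq_mul_operatorSqrt {α : Type*} [Fintype α]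
    (X : α → WeightSpace →L[ℂ] WeightSpace) {ρ : WeightSpace →L[ℂ] WeightSpace}
    (hρ : ρ = ∑ a, X a * ContinuousLinearMap.adjoint (X a))
    (T : WeightSpace →L[ℂ] WeightSpace) :
    hilbertSchmidtSq (T * operatorSqrt ρ) = ∑ a, hilbertSchmidtSq (T * X a) := by
  have hpos : ρ.IsPositive := by
    rw [hρ]
    exact ContinuousLinearMap.isPositive_sum _ fun a _ =>
      ContinuousLinearMap.isPositive_self_comp_adjoint (X a)
  have hadj : ∀ A B : WeightSpace →L[ℂ] WeightSpace, ContinuousLinearMap.adjoint (A * B)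
      = ContinuousLinearMap.adjoint B * ContinuousLinearMap.adjoint A :=
    ContinuousLinearMap.adjoint_comp
  -- Both sides are ⟨φ, ρφ⟩. This controls `√ρ` acting first, hence the passage to adjoints below.
  have hnorm : ∀ φ, ‖operatorSqrt ρ φ‖ ^ 2
      = ∑ a, ‖ContinuousLinearMap.adjoint (X a) φ‖ ^ 2 := by
    intro φ
    have h1 := inner_apply_eq_operatorSqrt hpos φ φ
    conv_lhs at h1 => rw [hρ]
    rw [sum_apply, inner_sum, inner_self_eq_norm_sq_to_K] at h1
    have h2 : ∀ a, ⟪φ, (X a * ContinuousLinearMap.adjoint (X a)) φ⟫_ℂ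
        = ((‖ContinuousLinearMap.adjoint (X a) φ‖ ^ 2 : ℝ) : ℂ) := fun a => by
      rw [mul_apply_eq_comp, ← ContinuousLinearMap.adjoint_inner_left, inner_self_eq_norm_sq_to_K]
      norm_cast
    simp only [h2] at h1
    rw [← Complex.ofReal_sum] at h1
    apply Complex.ofReal_injective
    rw [h1]
    norm_cast
  rw [← hilbertSchmidtSq_adjoint, hadj, operatorSqrt_adjoint]
  have h3 : ∀ a, hilbertSchmidtSq (T * X a)
      = hilbertSchmidtSq (ContinuousLinearMap.adjoint (X a) * ContinuousLinearMap.adjoint T) :=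
    fun a => by rw [← hilbertSchmidtSq_adjoint, hadj]
  simp only [h3]
  unfold hilbertSchmidtSq
  rw [← Summable.tsum_finsetSum fun _ _ => ENNReal.summable]
  refine tsum_congr fun k => ?_
  simp only [mul_apply_eq_comp, enorm_sq_eq_ofReal]
  rw [hnorm, ENNReal.ofReal_sum_of_nonneg fun _ _ => by positivity]

theorem IsDensityOperator.hilbertSchmidtSq_operatorSqrt {ρ : WeightSpace →L[ℂ] WeightSpace}
    (hρ : IsDensityOperator ρ) : hilbertSchmidtSq (operatorSqrt ρ) = 1 := by
  have h := Complex.hasSum_re hρ.hasSum_trace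
  have h1 : ∀ k, (⟪weightBasis k, ρ (weightBasis k)⟫_ℂ).re
      = ‖operatorSqrt ρ (weightBasis k)‖ ^ 2 := fun k => by
    rw [inner_apply_eq_operatorSqrt hρ.isPositive, inner_self_eq_norm_sq_to_K]
    norm_cast
  simp only [h1, Complex.one_re] at h
  unfold hilbertSchmidtSq
  simp only [enorm_sq_eq_ofReal]
  rw [← ENNReal.ofReal_tsum_of_nonneg (fun _ => by positivity) h.summable, h.tsum_eq,
    ENNReal.ofReal_one]

/-! ### Energy transport by energy-conserving unitaries -/

open scoped FourierTransform in
/-- An integrable function whose Fourier transform vanishes is zero almost everywhere. -/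
theorem ae_eq_zero_of_integral_exp_mul_eq_zero {f : ℝ → ℂ} (hf : Integrable f)
    (h : ∀ s : ℝ, ∫ E : ℝ, Complex.exp (Complex.I * s * E) * f E = 0) : ∀ᵐ E, f E = 0 := by
  have hF : ∀ w, 𝓕 f w = 0 := by
    intro w
    rw [Real.fourier_real_eq_integral_exp_smul, ← h (-(2 * Real.pi * w))]
    refine integral_congr_ae (Filter.Eventually.of_forall fun E => ?_)
    simp only [smul_eq_mul]
    congr 2
    push_cast
    ring
  apply ae_eq_zero_of_integral_contDiff_smul_eq_zero hf.locallyIntegrable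
  intro g g_smooth g_cpt
  have hg₁ : HasCompactSupport (Complex.ofRealCLM ∘ g) := g_cpt.comp_left rfl
  have hg₂ : ContDiff ℝ (⊤ : ℕ∞) (Complex.ofRealCLM ∘ g) :=
    Complex.ofRealCLM.contDiff.comp g_smooth
  set G : SchwartzMap ℝ ℂ := hg₁.toSchwartzMap hg₂
  have h1 : ∀ ξ, 𝓕 (𝓕⁻ G : SchwartzMap ℝ ℂ) ξ = (g ξ : ℂ) := fun ξ => by
    rw [FourierTransform.fourier_fourierInv_eq]
    rfl
  -- The test function is the Fourier transform of a Schwartz function; the transform is moved onto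
  -- `f`, where it vanishes.
  have h2 := VectorFourier.integral_fourierIntegral_smul_eq_flip (L := innerₗ ℝ)
    Real.continuous_fourierChar continuous_inner ((𝓕⁻ G : SchwartzMap ℝ ℂ).integrable (μ := volume)) hf
  have h3 : ∀ ξ, VectorFourier.fourierIntegral Real.fourierChar volume (innerₗ ℝ)
      (𝓕⁻ G : SchwartzMap ℝ ℂ) ξ = g ξ := h1
  have h4 : ∀ ξ, VectorFourier.fourierIntegral Real.fourierChar volume (innerₗ ℝ) f ξ = 0 := hF
  rw [flip_innerₗ] at h2
  simp only [h3, h4, smul_zero, integral_zero] at h2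
  simpa using h2

theorem integral_exp_mul_inner {α β : WeightSpace} (s : ℝ) :
    ⟪α, weightPhase s β⟫_ℂ = ∫ E : ℝ, Complex.exp (Complex.I * s * E) * ⟪α E, β E⟫_ℂ := by
  rw [L2.inner_def]
  apply integral_congr_ae
  filter_upwards [weightPhase_apply s β] with E h
  rw [h, ← smul_eq_mul, inner_smul_right]

/-- An operator that shifts energies by `d` does not connect `T` to `S` when `S + d` is disjoint
from `T`. -/
theorem cutoff_mul_mul_cutoff_eq_zero {W : WeightSpace →L[ℂ] WeightSpace} {d : ℝ}
    (hW : ∀ s : ℝ, W * weightPhase s = Complex.exp (Complex.I * s * d) • (weightPhase s * W))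
    {S T : Set ℝ} (hS : MeasurableSet S) (hT : MeasurableSet T) (hST : ∀ E ∈ S, E + d ∉ T) :
    cutoff hS * W * cutoff hT = 0 := by
  have key : ∀ φ ψ, ⟪cutoff hS φ, W (cutoff hT ψ)⟫_ℂ = 0 := by
    intro φ ψ
    set α := cutoff hS φ with hα
    set β := cutoff hT ψ with hβ
    set F₁ : ℝ → ℂ := fun E => ⟪ContinuousLinearMap.adjoint W α E, β E⟫_ℂ with hF₁
    set F₂ : ℝ → ℂ := fun E => ⟪α E, W β E⟫_ℂ with hF₂
    have hi₁ : Integrable F₁ := L2.integrable_inner _ _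
    have hi₂ : Integrable F₂ := L2.integrable_inner _ _
    have hi₃ : Integrable (fun E => F₂ (E - d)) := hi₂.comp_sub_right d
    have hbdd : ∀ (s : ℝ) (F : ℝ → ℂ), Integrable F →
        Integrable (fun E : ℝ => Complex.exp (Complex.I * s * E) * F E) := fun s F hF =>
      hF.bdd_mul (c := 1) (by fun_prop) (Filter.Eventually.of_forall fun E => by
        simp [Complex.norm_exp])
    -- The intertwining relation says that `F₁` and the translate of `F₂` have the same Fourier
    -- transform.
    have heq : ∀ᵐ E, F₁ E - F₂ (E - d) = 0 := by
      refine ae_eq_zero_of_integral_exp_mul_eq_zero (hi₁.sub hi₃) fun s => ?_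
      have h1 := congrArg (fun A : WeightSpace →L[ℂ] WeightSpace => ⟪α, A β⟫_ℂ) (hW s)
      simp only [mul_apply_eq_comp, smul_apply, inner_smul_right] at h1
      rw [← ContinuousLinearMap.adjoint_inner_left, integral_exp_mul_inner,
        integral_exp_mul_inner, ← integral_const_mul,
        ← integral_sub_right_eq_self (fun E : ℝ => Complex.exp (Complex.I * s * d)
          * (Complex.exp (Complex.I * s * E) * ⟪α E, W β E⟫_ℂ)) d] at h1
      simp only [mul_sub]
      rw [integral_sub (hbdd s _ hi₁) (hbdd s _ hi₃), sub_eq_zero]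
      refine h1.trans (integral_congr_ae (Filter.Eventually.of_forall fun E => ?_))
      simp only [hF₂]
      rw [← mul_assoc, ← Complex.exp_add]
      congr 2
      push_cast
      ring
    have h2 := (measurePreserving_sub_right volume d).quasiMeasurePreserving.ae
      (cutoff_apply hS φ)
    -- On `T` the translate of `F₂` vanishes because E - d is not in `S`; off `T` the vector `β`
    -- vanishes.
    have hzero : F₁ =ᵐ[volume] 0 := by
      filter_upwards [heq, h2, cutoff_apply hT ψ] with E h1 h2 h3
      by_cases hE : E ∈ T
      · have hE' : E - d ∉ S := fun h => hST _ h (by simpa using hE)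
        rw [sub_eq_zero] at h1
        rw [h1]
        simp [hF₂, hα, h2, hE']
      · simp [hF₁, hβ, h3, hE]
    rw [← ContinuousLinearMap.adjoint_inner_left, L2.inner_def, integral_congr_ae hzero]
    simp
  ext1 ψ
  refine ext_inner_left ℂ fun φ => ?_
  rw [mul_apply_eq_comp, mul_apply_eq_comp, ← ContinuousLinearMap.adjoint_inner_left,
    cutoff_adjoint, key]
  simp

/-! ### Energy tails before and after an admissible unitary -/

section Composite

variable {n : Type*} [Fintype n] [DecidableEq n]

theorem sum_norm_sq_of_star_mul_self {V : CompositeOperator n} (hV : star V * V = 1)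
    (x : n → WeightSpace) : ∑ i, ‖∑ j, V i j (x j)‖ ^ 2 = ∑ j, ‖x j‖ ^ 2 := by
  have h1 : ∀ j k, ∑ i, star (V i j) * V i k = if j = k then 1 else 0 := fun j k => by
    have := congrFun (congrFun hV j) k
    rw [Matrix.mul_apply, Matrix.one_apply] at this
    simpa using this
  have h2 : ∀ y : WeightSpace, ((‖y‖ ^ 2 : ℝ) : ℂ) = ⟪y, y⟫_ℂ := fun y => by
    rw [inner_self_eq_norm_sq_to_K]; norm_cast
  apply Complex.ofReal_injective
  rw [Complex.ofReal_sum, Complex.ofReal_sum]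
  simp only [h2, sum_inner, inner_sum]
  rw [Finset.sum_comm]
  refine Finset.sum_congr rfl fun k _ => ?_
  rw [Finset.sum_comm]
  have h3 : ∀ j, ∑ i, ⟪V i j (x j), V i k (x k)⟫_ℂ = if j = k then ⟪x j, x k⟫_ℂ else 0 := by
    intro j
    have h4 := congrArg (fun A : WeightSpace →L[ℂ] WeightSpace => ⟪x j, A (x k)⟫_ℂ) (h1 j k)
    simp only [sum_apply, inner_sum, mul_apply_eq_comp, ContinuousLinearMap.star_eq_adjoint,
      ContinuousLinearMap.adjoint_inner_right] at h4
    rw [h4]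
    split_ifs <;> simp
  simp [h3]

/-- The block for the system transition j → i changes the weight energy by exactly ε j - ε i, which
balances the energy of the system. -/
theorem IsWorkExtraction.entry_mul_weightPhase {ε : n → ℝ} {U : CompositeOperator n}
    (hU : IsWorkExtraction ε U) (i j : n) (s : ℝ) :
    U i j * weightPhase s
      = Complex.exp (Complex.I * s * ((ε i - ε j : ℝ) : ℂ)) • (weightPhase s * U i j) := by
  have h := congrFun (congrFun (hU.energy_conserving s).eq i) j
  rw [freeEvolution, Matrix.mul_diagonal, Matrix.diagonal_mul, mul_smul_comm,
    smul_mul_assoc] at h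
  have h2 := congrArg (fun A => Complex.exp (-(Complex.I * s * ε j)) • A) h
  simp only [smul_smul, ← Complex.exp_add] at h2
  rw [neg_add_cancel, Complex.exp_zero, one_smul] at h2
  rw [h2]
  congr 2
  push_cast
  ring

open scoped MatrixOrder Matrix.Norms.L2Operator in
/-- An admissible unitary changes the energy of the weight by at most the spectral diameter of the
system Hamiltonian. -/
theorem energyDistribution_compl_closedBall_le {ε : n → ℝ} {U : CompositeOperator n}
    (hU : IsWorkExtraction ε U) {ρS : Matrix n n ℂ} (hρS : IsDensityMatrix ρS)
    {ρW : WeightSpace →L[ℂ] WeightSpace} (hρW : ρW.IsPositive) {D : ℝ}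
    (hD : ∀ i j, |ε i - ε j| ≤ D) (m L : ℝ) :
    energyDistribution ρW (Metric.closedBall m (L + D))ᶜ
      ≤ energyDistribution (finalWeightState U ρS ρW) (Metric.closedBall m L)ᶜ := by
  -- With ρ_S = B†B the joint state is `Y * star Y` for Y = B† ⊗ √ρ_W, and the final weight state is
  -- a sum over the blocks of `U * Y`.
  obtain ⟨B, hB⟩ : ∃ B : Matrix n n ℂ, ρS = Bᴴ * B :=
    CStarAlgebra.nonneg_iff_eq_star_mul_self.1 hρS.posSemidef.nonneg
  set R := operatorSqrt ρW with hR
  set Y : CompositeOperator n := tensor Bᴴ R with hY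
  have hYapply : ∀ j l, Y j l = Bᴴ j l • R := fun j l => rfl
  have hstarR : star R = R := operatorSqrt_adjoint ρW
  have hYY : tensor ρS ρW = Y * star Y := by
    ext1 i j
    rw [Matrix.mul_apply]
    simp only [Matrix.star_apply, hYapply, star_smul, hstarR, smul_mul_smul_comm]
    rw [← Finset.sum_smul, operatorSqrt_mul_self hρW, hB, tensor, Matrix.of_apply,
      Matrix.mul_apply]
    simp
  have hfin : finalWeightState U ρS ρW = ∑ a : n × n,
      (U * Y) a.1 a.2 * ContinuousLinearMap.adjoint ((U * Y) a.1 a.2) := by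
    rw [finalWeightState, hYY, Fintype.sum_prod_type, partialTraceSystem]
    refine Finset.sum_congr rfl fun i _ => ?_
    rw [← mul_assoc, mul_assoc, ← star_mul, Matrix.mul_apply]
    rfl
  have htr : ∑ a : n × n, ‖Bᴴ a.1 a.2‖ₑ ^ 2 = 1 := by
    have h1 := hρS.trace_eq_one
    rw [hB, Matrix.trace] at h1
    simp only [Matrix.diag_apply, Matrix.mul_apply, Matrix.conjTranspose_apply, Complex.star_def,
      ← Complex.normSq_eq_conj_mul_self, Complex.normSq_eq_norm_sq] at h1
    simp only [enorm_sq_eq_ofReal]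
    rw [← ENNReal.ofReal_sum_of_nonneg fun _ _ => by positivity, Fintype.sum_prod_type,
      ← ENNReal.ofReal_one]
    congr 1
    simp only [Matrix.conjTranspose_apply, norm_star]
    exact_mod_cast h1
  have hST : ∀ i j, ∀ E ∈ Metric.closedBall m L,
      E + (ε i - ε j) ∉ (Metric.closedBall m (L + D))ᶜ := by
    intro i j E hE
    rw [Set.notMem_compl_iff, Metric.mem_closedBall, Real.dist_eq] at *
    calc |E + (ε i - ε j) - m| = |(E - m) + (ε i - ε j)| := by ring_nf
      _ ≤ |E - m| + |ε i - ε j| := abs_add_le _ _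
      _ ≤ L + D := add_le_add hE (hD i j)
  set P := cutoff (measurableSet_closedBall (x := m) (ε := L)).compl with hP
  set Q := cutoff (measurableSet_closedBall (x := m) (ε := L + D)).compl with hQ
  set P' := cutoff (measurableSet_closedBall (x := m) (ε := L)) with hP'
  have hPP : ∀ φ, P' φ + P φ = φ := by
    intro φ
    apply Lp.ext
    filter_upwards [cutoff_apply (measurableSet_closedBall (x := m) (ε := L)) φ,
      cutoff_apply (measurableSet_closedBall (x := m) (ε := L)).compl φ,
      Lp.coeFn_add (P' φ) (P φ)] with E h1 h2 h3
    rw [h3, Pi.add_apply, h1, h2]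
    by_cases h : E ∈ Metric.closedBall m L <;> simp [h]
  -- A block of U† moves energies by at most `D`, so it sends the smaller ball into the larger one.
  have hzero : ∀ i j φ, Q (star (U i j) (P' φ)) = 0 := by
    intro i j φ
    have h1 := cutoff_mul_mul_cutoff_eq_zero (hU.entry_mul_weightPhase i j)
      (measurableSet_closedBall (x := m) (ε := L))
      (measurableSet_closedBall (x := m) (ε := L + D)).compl (hST i j)
    have h2 := congrArg star h1
    rw [star_mul, star_mul, star_zero] at h2
    have h3 : star P' = P' := cutoff_adjoint _
    have h4 : star Q = Q := cutoff_adjoint _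
    rw [h3, h4] at h2
    exact congrArg (fun A : WeightSpace →L[ℂ] WeightSpace => A φ) h2
  have hUU := hU.mem_unitary
  rw [Unitary.mem_iff] at hUU
  have hback : ∀ j l φ, Y j l φ = ∑ i, star (U i j) ((U * Y) i l φ) := by
    intro j l φ
    have h1 : Y j l = (star U * (U * Y)) j l := by rw [← mul_assoc, hUU.1, one_mul]
    rw [h1, Matrix.mul_apply, sum_apply]
    rfl
  -- Since Y = U†(UY), the part of `Y` outside the larger ball comes only from the part of `U * Y`
  -- outside the smaller one, and U† is isometric.
  have hpoint : ∀ l φ, ∑ j, ‖Q (Y j l φ)‖ ^ 2 ≤ ∑ i, ‖P ((U * Y) i l φ)‖ ^ 2 := by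
    intro l φ
    have h1 := sum_norm_sq_of_star_mul_self (V := star U) (by rw [star_star, hUU.2])
      fun i => P ((U * Y) i l φ)
    rw [← h1]
    refine Finset.sum_le_sum fun j _ => ?_
    have h2 : Q (Y j l φ) = Q (∑ i, star U j i (P ((U * Y) i l φ))) := by
      rw [hback, map_sum, map_sum]
      refine Finset.sum_congr rfl fun i _ => ?_
      conv_lhs => rw [← hPP ((U * Y) i l φ), map_add, map_add, hzero, zero_add]
      rfl
    rw [h2]
    gcongr
    exact norm_cutoff_le _ _
  have hinit : energyDistribution ρW (Metric.closedBall m (L + D))ᶜ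
      = ∑ a : n × n, hilbertSchmidtSq (Q * Y a.1 a.2) := by
    rw [energyDistribution_apply _ (measurableSet_closedBall (x := m) (ε := L + D)).compl]
    simp only [hYapply, mul_smul_comm, hilbertSchmidtSq_smul]
    rw [← Finset.sum_mul, htr, one_mul]
  rw [hinit, energyDistribution_apply _ (measurableSet_closedBall (x := m) (ε := L)).compl,
    hilbertSchmidtSq_mul_operatorSqrt _ hfin]
  unfold hilbertSchmidtSq
  rw [← Summable.tsum_finsetSum fun _ _ => ENNReal.summable,
    ← Summable.tsum_finsetSum fun _ _ => ENNReal.summable]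
  refine ENNReal.tsum_le_tsum fun k => ?_
  rw [Fintype.sum_prod_type_right, Fintype.sum_prod_type_right]
  refine Finset.sum_le_sum fun l _ => ?_
  simp only [mul_apply_eq_comp, enorm_sq_eq_ofReal]
  rw [← ENNReal.ofReal_sum_of_nonneg fun _ _ => by positivity,
    ← ENNReal.ofReal_sum_of_nonneg fun _ _ => by positivity]
  exact ENNReal.ofReal_le_ofReal (hpoint l _)

end Composite

/-! ### Ergotropy of the system -/

section System

variable {n : Type*} [Fintype n] [DecidableEq n]

/-- Birkhoff's theorem in the form of a rearrangement bound. -/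
theorem mul_le_sum_of_doublyStochastic {b : n → n → ℝ} {t : ℝ} (ht : 0 ≤ t)
    (hb : ∀ i j, 0 ≤ b i j) (hrow : ∀ i, ∑ j, b i j = t) (hcol : ∀ j, ∑ i, b i j = t)
    (ε r : n → ℝ) {c : ℝ} (hc : ∀ π : Equiv.Perm n, c ≤ ∑ l, ε (π l) * r l) :
    c * t ≤ ∑ i, ∑ l, ε i * r l * b i l := by
  obtain ⟨M, hM, hbM⟩ := (exists_mem_doublyStochastic_eq_smul_iff (M := Matrix.of b) ht).2
    ⟨hb, hrow, hcol⟩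
  obtain ⟨w, hw0, hw1, hwM⟩ := exists_eq_sum_perm_of_mem_doublyStochastic hM
  have hbw : ∀ i l, b i l = t * ∑ π : Equiv.Perm n, w π * (if π i = l then 1 else 0) := by
    intro i l
    have h1 := congrFun (congrFun hbM i) l
    rw [Matrix.of_apply, Matrix.smul_apply, ← hwM, Matrix.sum_apply] at h1
    rw [h1]
    simp [Equiv.Perm.permMatrix, PEquiv.toMatrix_apply, Equiv.toPEquiv_apply, eq_comm]
  have h2 : ∑ i, ∑ l, ε i * r l * b i l
      = t * ∑ π : Equiv.Perm n, w π * ∑ l, ε (π⁻¹ l) * r l := by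
    have h3 : ∀ π : Equiv.Perm n, ∑ l, ε (π⁻¹ l) * r l
        = ∑ i, ∑ l, ε i * r l * (if π i = l then 1 else 0) := by
      intro π
      rw [← Equiv.sum_comp π]
      simp
    simp only [h3, hbw, Finset.mul_sum]
    conv_lhs =>
      enter [2, i]
      rw [Finset.sum_comm]
    rw [Finset.sum_comm]
    refine Finset.sum_congr rfl fun π _ => Finset.sum_congr rfl fun i _ =>
      Finset.sum_congr rfl fun l _ => by ring
  rw [h2, mul_comm]
  refine mul_le_mul_of_nonneg_left ?_ ht
  calc c = ∑ π : Equiv.Perm n, w π * c := by rw [← Finset.sum_mul, hw1, one_mul]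
    _ ≤ _ := Finset.sum_le_sum fun π _ => mul_le_mul_of_nonneg_left (hc _) (hw0 π)

theorem sum_norm_sq_sum_smul {E : Type*} [NormedAddCommGroup E] [InnerProductSpace ℂ E]
    {V : Matrix n n ℂ} (hV : Vᴴ * V = 1) (x : n → E) :
    ∑ i, ‖∑ j, V i j • x j‖ ^ 2 = ∑ j, ‖x j‖ ^ 2 := by
  have h1 : ∀ j k, ∑ i, star (V i j) * V i k = if j = k then 1 else 0 := fun j k => by
    have := congrFun (congrFun hV j) k
    rw [Matrix.mul_apply, Matrix.one_apply] at this
    simpa using this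
  have h2 : ∀ y : E, ((‖y‖ ^ 2 : ℝ) : ℂ) = ⟪y, y⟫_ℂ := fun y => by
    rw [inner_self_eq_norm_sq_to_K]; norm_cast
  apply Complex.ofReal_injective
  rw [Complex.ofReal_sum, Complex.ofReal_sum]
  simp only [h2, sum_inner, inner_sum]
  rw [Finset.sum_comm]
  refine Finset.sum_congr rfl fun k _ => ?_
  rw [Finset.sum_comm]
  have h3 : ∀ j, ∑ i, ⟪V i j • x j, V i k • x k⟫_ℂ = if j = k then ⟪x j, x k⟫_ℂ else 0 := by
    intro j
    simp only [inner_smul_left, inner_smul_right, ← mul_assoc, ← Finset.sum_mul]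
    have h4 : ∑ i, V i k * (starRingEnd ℂ) (V i j) = if j = k then 1 else 0 := by
      rw [← h1 j k]
      exact Finset.sum_congr rfl fun i _ => mul_comm _ _
    rw [h4, ite_mul, one_mul, zero_mul]
  simp_rw [h3]
  simp

theorem sum_norm_sq_col {V : Matrix n n ℂ} (hV : Vᴴ * V = 1) (j : n) :
    ∑ i, ‖V i j‖ ^ 2 = 1 := by
  have h := sum_norm_sq_sum_smul hV (fun k : n => if k = j then (1 : ℂ) else 0)
  simpa [apply_ite] using h

theorem sum_norm_sq_row {V : Matrix n n ℂ} (hV : V * Vᴴ = 1) (i : n) :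
    ∑ j, ‖V i j‖ ^ 2 = 1 := by
  simpa using sum_norm_sq_col (V := Vᴴ) (by simpa using hV) i

theorem conjTranspose_mul_self_of_mem {V : Matrix n n ℂ} (hV : V ∈ Matrix.unitaryGroup n ℂ) :
    Vᴴ * V = 1 := Matrix.mem_unitaryGroup_iff'.1 hV

theorem mul_conjTranspose_self_of_mem {V : Matrix n n ℂ} (hV : V ∈ Matrix.unitaryGroup n ℂ) :
    V * Vᴴ = 1 := Matrix.mem_unitaryGroup_iff.1 hV

/-- The rotated Hamiltonian `V† H_S V`. -/
def rotatedHamiltonian (ε : n → ℝ) (V : Matrix n n ℂ) : Matrix n n ℂ :=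
  Vᴴ * systemHamiltonian ε * V

theorem rotatedHamiltonian_apply (ε : n → ℝ) (V : Matrix n n ℂ) (i j : n) :
    rotatedHamiltonian ε V i j = ∑ k, star (V k i) * ε k * V k j := by
  rw [rotatedHamiltonian, systemHamiltonian, Matrix.mul_apply]
  simp only [Matrix.mul_diagonal, Matrix.conjTranspose_apply]

theorem norm_rotatedHamiltonian_apply_le (ε : n → ℝ) {V : Matrix n n ℂ}
    (hV : V ∈ Matrix.unitaryGroup n ℂ) (i j : n) :
    ‖rotatedHamiltonian ε V i j‖ ≤ ∑ k, |ε k| := by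
  rw [rotatedHamiltonian_apply]
  refine (norm_sum_le _ _).trans (Finset.sum_le_sum fun k _ => ?_)
  rw [norm_mul, norm_mul, norm_star, Complex.norm_real, Real.norm_eq_abs]
  have h1 := entry_norm_bound_of_unitary hV k i
  have h2 := entry_norm_bound_of_unitary hV k j
  calc ‖V k i‖ * |ε k| * ‖V k j‖ ≤ 1 * |ε k| * 1 := by gcongr
    _ = _ := by ring

theorem workOperator_mul_trace (ε : n → ℝ) (V ρ : Matrix n n ℂ) :
    (workOperator ε V * ρ).trace
      = (systemHamiltonian ε * ρ).trace - (rotatedHamiltonian ε V * ρ).trace := by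
  rw [workOperator, sub_mul, Matrix.trace_sub, rotatedHamiltonian]

theorem norm_trace_rotatedHamiltonian_mul_le (ε : n → ℝ) {V : Matrix n n ℂ}
    (hV : V ∈ Matrix.unitaryGroup n ℂ) (ρ : Matrix n n ℂ) :
    ‖(rotatedHamiltonian ε V * ρ).trace‖ ≤ ∑ i, ∑ j, (∑ k, |ε k|) * ‖ρ j i‖ := by
  rw [Matrix.trace]
  refine (norm_sum_le _ _).trans (Finset.sum_le_sum fun i _ => ?_)
  rw [Matrix.diag_apply, Matrix.mul_apply]
  refine (norm_sum_le _ _).trans (Finset.sum_le_sum fun j _ => ?_)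
  rw [norm_mul]
  gcongr
  exact norm_rotatedHamiltonian_apply_le ε hV i j

theorem trace_workOperator_re_le (ε : n → ℝ) {V : Matrix n n ℂ}
    (hV : V ∈ Matrix.unitaryGroup n ℂ) (ρ : Matrix n n ℂ) :
    ((workOperator ε V * ρ).trace).re
      ≤ ((systemHamiltonian ε * ρ).trace).re + ∑ i, ∑ j, (∑ k, |ε k|) * ‖ρ j i‖ := by
  rw [workOperator_mul_trace, Complex.sub_re, sub_eq_add_neg]
  gcongr
  have h := norm_trace_rotatedHamiltonian_mul_le ε hV ρ
  have h2 := Complex.abs_re_le_norm (rotatedHamiltonian ε V * ρ).trace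
  linarith [neg_abs_le ((rotatedHamiltonian ε V * ρ).trace).re]

theorem le_ergotropy (ε : n → ℝ) {V : Matrix n n ℂ} (hV : V ∈ Matrix.unitaryGroup n ℂ)
    (ρ : Matrix n n ℂ) : ((workOperator ε V * ρ).trace).re ≤ ergotropy ε ρ :=
  le_ciSup (f := fun V : Matrix.unitaryGroup n ℂ => ((workOperator ε V.1 * ρ).trace).re)
    ⟨_, by rintro _ ⟨V, rfl⟩; exact trace_workOperator_re_le ε V.2 ρ⟩ ⟨V, hV⟩

theorem le_incoherentErgotropy (ε : n → ℝ) {V : Matrix n n ℂ}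
    (hV : V ∈ Matrix.unitaryGroup n ℂ) (hc : Commute (workOperator ε V) (systemHamiltonian ε))
    (ρ : Matrix n n ℂ) : ((workOperator ε V * ρ).trace).re ≤ incoherentErgotropy ε ρ :=
  le_ciSup (f := fun V : {V : Matrix.unitaryGroup n ℂ //
      Commute (workOperator ε (V : Matrix n n ℂ)) (systemHamiltonian ε)} =>
      ((workOperator ε V.1.1 * ρ).trace).re)
    ⟨_, by rintro _ ⟨V, rfl⟩; exact trace_workOperator_re_le ε V.1.2 ρ⟩ ⟨⟨V, hV⟩, hc⟩

theorem ergotropy_le {ε : n → ℝ} {ρ : Matrix n n ℂ} {c : ℝ}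
    (h : ∀ V ∈ Matrix.unitaryGroup n ℂ, ((workOperator ε V * ρ).trace).re ≤ c) :
    ergotropy ε ρ ≤ c :=
  ciSup_le fun V => h V.1 V.2

/-- Permutations of an orthonormal basis are implemented by unitaries. -/
theorem exists_rotatedHamiltonian_eq (ε : n → ℝ) {A : Matrix n n ℂ}
    (hA : A ∈ Matrix.unitaryGroup n ℂ) (π : Equiv.Perm n) :
    ∃ V ∈ Matrix.unitaryGroup n ℂ,
      rotatedHamiltonian ε V = A * Matrix.diagonal (fun l => (ε (π l) : ℂ)) * Aᴴ := by
  -- This unitary sends column `l` of `A` to the energy eigenvector with index `π l`.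
  refine ⟨Aᴴ.submatrix π.symm id, ?_, ?_⟩
  · rw [Matrix.mem_unitaryGroup_iff, Matrix.star_eq_conjTranspose, Matrix.conjTranspose_submatrix,
      Matrix.conjTranspose_conjTranspose]
    ext i j
    have h := congrFun (congrFun (conjTranspose_mul_self_of_mem hA) (π.symm i)) (π.symm j)
    rw [Matrix.mul_apply] at h ⊢
    simp only [Matrix.submatrix_apply, id]
    rw [h]
    simp [Matrix.one_apply]
  · ext i j
    rw [rotatedHamiltonian_apply, ← Equiv.sum_comp π, Matrix.mul_apply]
    simp [Matrix.mul_diagonal]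

theorem trace_diagonal_conj_mul {A : Matrix n n ℂ} (hA : A ∈ Matrix.unitaryGroup n ℂ)
    (f r : n → ℝ) :
    ((A * Matrix.diagonal (fun l => (f l : ℂ)) * Aᴴ)
        * (A * Matrix.diagonal (fun l => (r l : ℂ)) * Aᴴ)).trace = ((∑ l, f l * r l : ℝ) : ℂ) := by
  have h : (A * Matrix.diagonal (fun l => (f l : ℂ)) * Aᴴ)
        * (A * Matrix.diagonal (fun l => (r l : ℂ)) * Aᴴ)
      = A * Matrix.diagonal (fun l => ((f l * r l : ℝ) : ℂ)) * Aᴴ := by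
    have h2 : (fun l => ((f l * r l : ℝ) : ℂ)) = fun l => (f l : ℂ) * (r l : ℂ) := by
      ext; push_cast; rfl
    rw [h2, ← Matrix.diagonal_mul_diagonal]
    calc _ = A * Matrix.diagonal (fun l => (f l : ℂ)) * (Aᴴ * A)
          * Matrix.diagonal (fun l => (r l : ℂ)) * Aᴴ := by simp only [mul_assoc]
      _ = _ := by rw [conjTranspose_mul_self_of_mem hA, mul_one, mul_assoc A]
  rw [h, Matrix.trace_mul_comm, ← mul_assoc, conjTranspose_mul_self_of_mem hA, one_mul,
    Matrix.trace_diagonal]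
  push_cast
  rfl

/-- The mean energy `Tr[V† H V ρ]` in terms of the transition probabilities between the energy
eigenvectors and the eigenvectors of `ρ`. -/
theorem trace_rotatedHamiltonian_mul (ε r : n → ℝ) (V A : Matrix n n ℂ) :
    (rotatedHamiltonian ε V * (A * Matrix.diagonal (fun l => (r l : ℂ)) * Aᴴ)).trace
      = ((∑ i, ∑ l, ε i * r l * ‖(V * A) i l‖ ^ 2 : ℝ) : ℂ) := by
  have h : (rotatedHamiltonian ε V * (A * Matrix.diagonal (fun l => (r l : ℂ)) * Aᴴ)).trace
      = (systemHamiltonian ε * ((V * A) * Matrix.diagonal (fun l => (r l : ℂ)) * (V * A)ᴴ)).trace := by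
    rw [rotatedHamiltonian, mul_assoc, mul_assoc, Matrix.trace_mul_comm, Matrix.conjTranspose_mul]
    simp only [mul_assoc]
  rw [h, Matrix.trace, Complex.ofReal_sum]
  refine Finset.sum_congr rfl fun i _ => ?_
  rw [Matrix.diag_apply, systemHamiltonian, Matrix.diagonal_mul, Matrix.mul_apply,
    Finset.mul_sum, Complex.ofReal_sum]
  refine Finset.sum_congr rfl fun l _ => ?_
  rw [Matrix.mul_diagonal, Matrix.conjTranspose_apply, Complex.star_def]
  push_cast
  rw [← Complex.mul_conj']
  ring

theorem exists_unitary_diagonalization {ρ : Matrix n n ℂ} (hρ : ρ.IsHermitian) :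
    ∃ A ∈ Matrix.unitaryGroup n ℂ, ∃ r : n → ℝ,
      ρ = A * Matrix.diagonal (fun l => (r l : ℂ)) * Aᴴ :=
  ⟨hρ.eigenvectorUnitary, hρ.eigenvectorUnitary.2, hρ.eigenvalues, by
    conv_lhs => rw [hρ.spectral_theorem]
    rfl⟩

/-- The state dephased in the eigenspaces of the Hamiltonian. -/
def dephased (ε : n → ℝ) (ρ : Matrix n n ℂ) : Matrix n n ℂ :=
  Matrix.of fun i j => if ε i = ε j then ρ i j else 0

theorem dephased_apply {n : Type*} (ε : n → ℝ) (ρ : Matrix n n ℂ) (i j : n) :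
    dephased ε ρ i j = if ε i = ε j then ρ i j else 0 := rfl

theorem commute_systemHamiltonian_iff {ε : n → ℝ} {A : Matrix n n ℂ} :
    Commute A (systemHamiltonian ε) ↔ ∀ i j, ε i ≠ ε j → A i j = 0 := by
  rw [commute_iff_eq, ← Matrix.ext_iff]
  simp only [systemHamiltonian, Matrix.mul_diagonal, Matrix.diagonal_mul]
  refine forall_congr' fun i => forall_congr' fun j => ?_
  constructor
  · intro h hij
    have h2 : ((ε j : ℂ) - ε i) * A i j = 0 := by linear_combination h
    refine (mul_eq_zero.1 h2).resolve_left ?_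
    exact fun h => hij (by exact_mod_cast (sub_eq_zero.1 h).symm)
  · intro h
    by_cases hij : ε i = ε j
    · rw [hij, mul_comm]
    · rw [h hij]; simp

theorem trace_mul_dephased {ε : n → ℝ} {A : Matrix n n ℂ}
    (hA : Commute A (systemHamiltonian ε)) (ρ : Matrix n n ℂ) :
    (A * dephased ε ρ).trace = (A * ρ).trace := by
  rw [commute_systemHamiltonian_iff] at hA
  simp only [Matrix.trace, Matrix.diag_apply, Matrix.mul_apply, dephased_apply]
  refine Finset.sum_congr rfl fun i _ => Finset.sum_congr rfl fun j _ => ?_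
  split_ifs with h
  · rfl
  · rw [hA i j (Ne.symm h)]; simp

theorem sum_eq_sum_fiber {n M : Type*} [Fintype n] [AddCommMonoid M] (ε : n → ℝ) (e : ℝ) (f : n → M)
    (hf : ∀ i, ε i ≠ e → f i = 0) : ∑ i, f i = ∑ i : {i // ε i = e}, f i := by
  rw [← Finset.sum_subtype (Finset.univ.filter fun i => ε i = e) (by simp) f]
  exact (Finset.sum_subset (Finset.filter_subset _ _) fun i _ hi => hf i (by simpa using hi)).symm

/-- A dephased state has an eigenbasis of energy eigenvectors. -/
theorem exists_unitary_diagonalization_dephased (ε : n → ℝ) {ρ : Matrix n n ℂ}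
    (hρ : ρ.IsHermitian) :
    ∃ A ∈ Matrix.unitaryGroup n ℂ, Commute A (systemHamiltonian ε) ∧ ∃ r : n → ℝ,
      dephased ε ρ = A * Matrix.diagonal (fun l => (r l : ℂ)) * Aᴴ := by
  set B : (e : ℝ) → Matrix {i // ε i = e} {i // ε i = e} ℂ :=
    fun e => ρ.submatrix Subtype.val Subtype.val
  have hB : ∀ e, (B e).IsHermitian := fun e => hρ.submatrix _
  -- Each energy eigenspace is diagonalized separately, and the blocks are glued into `A`.
  choose U hU r hr using fun e => exists_unitary_diagonalization (hB e)
  set A : Matrix n n ℂ := Matrix.of fun i l => if h : ε i = ε l then U (ε l) ⟨i, h⟩ ⟨l, rfl⟩ else 0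
    with hA
  have hA0 : ∀ i l, ε i ≠ ε l → A i l = 0 := fun i l h => by simp [hA, h]
  have hA1 : ∀ e (i l : {i // ε i = e}), A i l = U e i l := by
    rintro _ ⟨i, hi⟩ ⟨l, rfl⟩
    simp [hA, hi]
  have hAU : Aᴴ * A = 1 := by
    ext k l
    rw [Matrix.mul_apply]
    by_cases hkl : ε k = ε l
    · rw [sum_eq_sum_fiber ε (ε l) _ fun i hi => by rw [hA0 i l hi, mul_zero]]
      have h := congrFun (congrFun (conjTranspose_mul_self_of_mem (hU (ε l))) ⟨k, hkl⟩) ⟨l, rfl⟩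
      rw [Matrix.mul_apply] at h
      simp only [Matrix.conjTranspose_apply, ← hA1] at h ⊢
      rw [h]
      simp [Matrix.one_apply]
    · rw [Matrix.one_apply_ne (fun h => hkl (by rw [h]))]
      refine Finset.sum_eq_zero fun i _ => ?_
      by_cases hi : ε i = ε l
      · rw [Matrix.conjTranspose_apply, hA0 i k (fun h => hkl (h.symm.trans hi))]; simp
      · rw [hA0 i l hi, mul_zero]
  have hAmem : A ∈ Matrix.unitaryGroup n ℂ := Matrix.mem_unitaryGroup_iff'.2 hAU
  refine ⟨A, hAmem, commute_systemHamiltonian_iff.2 hA0, fun l => r (ε l) ⟨l, rfl⟩, ?_⟩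
  have hr1 : ∀ e (l : {i // ε i = e}), r (ε l) ⟨l, rfl⟩ = r e l := by
    rintro _ ⟨l, rfl⟩
    rfl
  have hDA : dephased ε ρ * A = A * Matrix.diagonal fun l => ((r (ε l) ⟨l, rfl⟩ : ℝ) : ℂ) := by
    ext i l
    rw [Matrix.mul_diagonal, Matrix.mul_apply,
      sum_eq_sum_fiber ε (ε l) _ fun j hj => by rw [hA0 j l hj, mul_zero]]
    by_cases hil : ε i = ε l
    · have h1 : B (ε l) * U (ε l) = U (ε l) * Matrix.diagonal fun k => (r (ε l) k : ℂ) := by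
        conv_lhs => rw [hr (ε l), mul_assoc, conjTranspose_mul_self_of_mem (hU (ε l)), mul_one]
      have h := congrFun (congrFun h1 ⟨i, hil⟩) ⟨l, rfl⟩
      rw [Matrix.mul_apply, Matrix.mul_diagonal, ← hA1] at h
      rw [← h]
      refine Finset.sum_congr rfl fun j _ => ?_
      rw [← hA1, dephased_apply, if_pos (hil.trans j.2.symm)]
      rfl
    · rw [hA0 i l hil, zero_mul]
      refine Finset.sum_eq_zero fun j _ => ?_
      rw [dephased_apply, if_neg (fun h => hil (h.trans j.2)), zero_mul]
  rw [← hDA, mul_assoc, mul_conjTranspose_self_of_mem hAmem, mul_one]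

/-- The minimal mean energy that is reached from `ρ` by unitaries. -/
def passiveEnergy (ε : n → ℝ) (ρ : Matrix n n ℂ) : ℝ :=
  ((systemHamiltonian ε * ρ).trace).re - ergotropy ε ρ

theorem passiveEnergy_le (ε : n → ℝ) {V : Matrix n n ℂ} (hV : V ∈ Matrix.unitaryGroup n ℂ)
    (ρ : Matrix n n ℂ) : passiveEnergy ε ρ ≤ ((rotatedHamiltonian ε V * ρ).trace).re := by
  have h := le_ergotropy ε hV ρ
  rw [workOperator_mul_trace, Complex.sub_re] at h
  rw [passiveEnergy]
  linarith

theorem passiveEnergy_le_sum_perm (ε r : n → ℝ) {A : Matrix n n ℂ}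
    (hA : A ∈ Matrix.unitaryGroup n ℂ) (π : Equiv.Perm n) :
    passiveEnergy ε (A * Matrix.diagonal (fun l => (r l : ℂ)) * Aᴴ) ≤ ∑ l, ε (π l) * r l := by
  obtain ⟨V, hV, hVA⟩ := exists_rotatedHamiltonian_eq ε hA π
  refine (passiveEnergy_le ε hV _).trans_eq ?_
  rw [hVA, trace_diagonal_conj_mul hA (fun l => ε (π l)) r, Complex.ofReal_re]

/-- The coherent ergotropy is gained only from the coherences: for a dephased state the minimal mean
energy is higher by at least the coherent ergotropy. -/
theorem passiveEnergy_add_coherentErgotropy_le (ε : n → ℝ) {V : Matrix n n ℂ}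
    (hV : V ∈ Matrix.unitaryGroup n ℂ) {ρ : Matrix n n ℂ} (hρ : ρ.IsHermitian) :
    passiveEnergy ε ρ + coherentErgotropy ε ρ
      ≤ ((rotatedHamiltonian ε V * dephased ε ρ).trace).re := by
  obtain ⟨A, hA, hAH, r, hr⟩ := exists_unitary_diagonalization_dephased ε hρ
  rw [passiveEnergy, coherentErgotropy, sub_add_sub_cancel, hr, trace_rotatedHamiltonian_mul,
    Complex.ofReal_re]
  have hVA := mul_mem hV hA
  rw [← mul_one (_ - _)]
  -- By Birkhoff only permutations of the eigenbasis of the dephased state matter. That basis lies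
  -- in the energy eigenspaces, so the permuting unitary is incoherent, and its work operator has
  -- the same expectation in ρ and in the dephased state.
  refine mul_le_sum_of_doublyStochastic zero_le_one (fun _ _ => by positivity)
    (fun i => sum_norm_sq_row (mul_conjTranspose_self_of_mem hVA) i)
    (fun l => sum_norm_sq_col (conjTranspose_mul_self_of_mem hVA) l) ε r fun π => ?_
  obtain ⟨W, hW, hWA⟩ := exists_rotatedHamiltonian_eq ε hA π
  have hAH' : Commute Aᴴ (systemHamiltonian ε) := by
    rw [commute_systemHamiltonian_iff] at hAH ⊢
    intro i j hij
    rw [Matrix.conjTranspose_apply, hAH j i hij.symm, star_zero]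
  have hdiag : ∀ f : n → ℂ, Commute (Matrix.diagonal f) (systemHamiltonian ε) := fun f => by
    rw [commute_systemHamiltonian_iff]
    intro i j hij
    exact Matrix.diagonal_apply_ne _ fun h => hij (by rw [h])
  have hcomm : Commute (workOperator ε W) (systemHamiltonian ε) := by
    have h : workOperator ε W = systemHamiltonian ε - rotatedHamiltonian ε W := rfl
    rw [h, hWA]
    exact (Commute.refl _).sub_left ((hAH.mul_left (hdiag _)).mul_left hAH')
  have h1 := le_incoherentErgotropy ε hW hcomm ρ
  rw [← trace_mul_dephased hcomm, workOperator_mul_trace, trace_mul_dephased (Commute.refl _),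
    hWA, hr, trace_diagonal_conj_mul hA (fun l => ε (π l)) r, Complex.sub_re,
    Complex.ofReal_re] at h1
  linarith

end System

/-! ### Loss of ergotropy in the control-marginal state -/

section Composite

variable {n : Type*} [Fintype n] [DecidableEq n]

/-- The formal combination of displacements that represents the excess of the mean energy
`Tr[V† H_S V σ_S]` over its minimal value. -/
def excessSymbol (ε : n → ℝ) (ρ V : Matrix n n ℂ) : AddMonoidAlgebra ℂ ℝ :=
  ∑ i, ∑ j, AddMonoidAlgebra.single (ε i - ε j) (rotatedHamiltonian ε V j i * ρ i j)
    - AddMonoidAlgebra.single 0 (passiveEnergy ε ρ : ℂ)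

/-- The set of energy gaps of the system. -/
def energyGaps (ε : n → ℝ) : Finset ℝ :=
  insert 0 (Finset.univ.image fun a : n × n => ε a.1 - ε a.2)

theorem excessSymbol_support_subset (ε : n → ℝ) (ρ V : Matrix n n ℂ) :
    (excessSymbol ε ρ V).coeff.support ⊆ energyGaps ε := by
  intro a ha
  by_contra hna
  rw [energyGaps, Finset.mem_insert, Finset.mem_image, not_or] at hna
  apply Finsupp.mem_support_iff.1 ha
  have h1 : ∀ i j, ε i - ε j ≠ a := fun i j h => hna.2 ⟨(i, j), Finset.mem_univ _, h⟩
  simp [excessSymbol, h1, Ne.symm hna.1]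

/-- The gap ε i - ε j vanishes exactly on pairs of equal energy, which are the entries kept by
dephasing. -/
theorem excessSymbol_coeff_zero (ε : n → ℝ) (ρ V : Matrix n n ℂ) :
    (excessSymbol ε ρ V).coeff 0
      = (rotatedHamiltonian ε V * dephased ε ρ).trace - passiveEnergy ε ρ := by
  have h : (rotatedHamiltonian ε V * dephased ε ρ).trace
      = ∑ i, ∑ j, if ε i = ε j then rotatedHamiltonian ε V j i * ρ i j else 0 := by
    rw [Matrix.trace, Finset.sum_comm]
    refine Finset.sum_congr rfl fun i _ => ?_
    rw [Matrix.diag_apply, Matrix.mul_apply]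
    refine Finset.sum_congr rfl fun j _ => ?_
    rw [dephased_apply, mul_ite, mul_zero]
  rw [h]
  simp only [excessSymbol, AddMonoidAlgebra.coeff_sub, AddMonoidAlgebra.coeff_sum,
    AddMonoidAlgebra.coeff_single, Finsupp.sub_apply, Finsupp.finsetSum_apply,
    Finsupp.single_apply, sub_eq_zero, if_true]

theorem displacementHom_excessSymbol (ε : n → ℝ) (ρ V : Matrix n n ℂ) :
    displacementHom (excessSymbol ε ρ V)
      = ∑ i, ∑ j, (rotatedHamiltonian ε V j i * ρ i j) • displacement (ε i - ε j)
        - (passiveEnergy ε ρ : ℂ) • (1 : WeightSpace →L[ℂ] WeightSpace) := by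
  simp [excessSymbol, displacement_zero]

theorem inner_displacement_sub (a b : ℝ) (φ : WeightSpace) :
    ⟪φ, displacement (a - b) φ⟫_ℂ = ⟪displacement b φ, displacement a φ⟫_ℂ := by
  rw [← displacement_inner b φ, ← mul_apply_eq_comp, ← displacement_add, add_sub_cancel]

theorem inner_excess (ε : n → ℝ) (ρ V : Matrix n n ℂ) (φ : WeightSpace) :
    ⟪φ, displacementHom (excessSymbol ε ρ V) φ⟫_ℂ
      = ∑ i, ∑ j, rotatedHamiltonian ε V j i * ρ i j
          * ⟪displacement (ε j) φ, displacement (ε i) φ⟫_ℂ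
        - passiveEnergy ε ρ * ((‖φ‖ ^ 2 : ℝ) : ℂ) := by
  have h : ⟪φ, φ⟫_ℂ = ((‖φ‖ ^ 2 : ℝ) : ℂ) := by
    rw [inner_self_eq_norm_sq_to_K]; norm_cast
  rw [displacementHom_excessSymbol]
  simp only [sub_apply, sum_apply, smul_apply, inner_sub_right, inner_sum, inner_smul_right,
    inner_displacement_sub, one_apply_eq_self, h]

theorem sum_rotate {n M : Type*} [Fintype n] [AddCommMonoid M] (F : n → n → n → n → M) :
    ∑ k, ∑ l, ∑ j, ∑ i, F k l j i = ∑ i, ∑ j, ∑ k, ∑ l, F k l j i := by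
  calc ∑ k, ∑ l, ∑ j, ∑ i, F k l j i = ∑ k, ∑ i, ∑ l, ∑ j, F k l j i :=
        Finset.sum_congr rfl fun k _ =>
          (Finset.sum_congr rfl fun l _ => Finset.sum_comm).trans Finset.sum_comm
    _ = ∑ i, ∑ k, ∑ j, ∑ l, F k l j i := by
        rw [Finset.sum_comm]
        exact Finset.sum_congr rfl fun i _ => Finset.sum_congr rfl fun k _ => Finset.sum_comm
    _ = _ := Finset.sum_congr rfl fun i _ => Finset.sum_comm

/-- In the eigenbasis of `ρ` the quadratic form is a mean energy with doubly stochastic weights,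
minus the passive energy; by Birkhoff no such mixture goes below the optimal permutation. -/
theorem displacementHom_excessSymbol_isPositive (ε : n → ℝ) {ρ V : Matrix n n ℂ}
    (hρ : ρ.IsHermitian) (hV : V ∈ Matrix.unitaryGroup n ℂ) :
    (displacementHom (excessSymbol ε ρ V)).IsPositive := by
  obtain ⟨A, hA, r, hr⟩ := exists_unitary_diagonalization hρ
  rw [ContinuousLinearMap.isPositive_iff_complex]
  intro φ
  -- Rows and columns of `b` sum to ‖φ‖², because `V` and `A` are unitary and displacements are
  -- isometric.
  set b : n → n → ℝ := fun k l => ‖∑ i, (V k i * A i l) • displacement (ε i) φ‖ ^ 2 with hb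
  have hform : ⟪φ, displacementHom (excessSymbol ε ρ V) φ⟫_ℂ
      = ((∑ k, ∑ l, ε k * r l * b k l - passiveEnergy ε ρ * ‖φ‖ ^ 2 : ℝ) : ℂ) := by
    have hbC : ∀ k l, ((b k l : ℝ) : ℂ) = ∑ j, ∑ i, star (V k j * A j l) * (V k i * A i l)
        * ⟪displacement (ε j) φ, displacement (ε i) φ⟫_ℂ := by
      intro k l
      have h1 : ((b k l : ℝ) : ℂ) = ⟪∑ i, (V k i * A i l) • displacement (ε i) φ,
          ∑ i, (V k i * A i l) • displacement (ε i) φ⟫_ℂ := by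
        rw [inner_self_eq_norm_sq_to_K, hb]; norm_cast
      rw [h1, sum_inner]
      refine Finset.sum_congr rfl fun j _ => ?_
      rw [inner_sum]
      refine Finset.sum_congr rfl fun i _ => ?_
      rw [inner_smul_left, inner_smul_right, Complex.star_def]
      ring
    have hρij : ∀ i j, ρ i j = ∑ l, A i l * r l * star (A j l) := fun i j => by
      rw [hr, Matrix.mul_apply]
      simp only [Matrix.mul_diagonal, Matrix.conjTranspose_apply]
    rw [inner_excess]
    push_cast
    congr 1
    simp only [hbC, Finset.mul_sum]
    rw [sum_rotate]
    refine Finset.sum_congr rfl fun i _ => Finset.sum_congr rfl fun j _ => ?_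
    rw [hρij, rotatedHamiltonian_apply, Finset.sum_mul_sum, Finset.sum_mul]
    refine Finset.sum_congr rfl fun k _ => ?_
    rw [Finset.sum_mul]
    refine Finset.sum_congr rfl fun l _ => ?_
    rw [star_mul']
    ring
  have hbirk : passiveEnergy ε ρ * ‖φ‖ ^ 2 ≤ ∑ k, ∑ l, ε k * r l * b k l := by
    refine mul_le_sum_of_doublyStochastic (by positivity) (fun _ _ => by positivity)
      (fun k => ?_) (fun l => ?_) ε r fun π => ?_
    · have h1 := sum_norm_sq_sum_smul (V := Aᵀ) (by
        have := congrArg Matrix.transpose (mul_conjTranspose_self_of_mem hA)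
        rwa [Matrix.transpose_mul, Matrix.transpose_one] at this)
        fun i => V k i • displacement (ε i) φ
      simp only [Matrix.transpose_apply, smul_smul, norm_smul, displacement_norm, mul_pow] at h1
      rw [← Finset.sum_mul, sum_norm_sq_row (mul_conjTranspose_self_of_mem hV), one_mul] at h1
      rw [← h1]
      simp only [hb, mul_comm]
    · have h1 := sum_norm_sq_sum_smul (conjTranspose_mul_self_of_mem hV)
        fun i => A i l • displacement (ε i) φ
      simp only [smul_smul, norm_smul, displacement_norm, mul_pow] at h1
      rw [← Finset.sum_mul, sum_norm_sq_col (conjTranspose_mul_self_of_mem hA), one_mul] at h1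
      exact h1
    · conv_lhs => rw [hr]
      exact passiveEnergy_le_sum_perm ε r hA π
  have h2 : ⟪displacementHom (excessSymbol ε ρ V) φ, φ⟫_ℂ
      = ((∑ k, ∑ l, ε k * r l * b k l - passiveEnergy ε ρ * ‖φ‖ ^ 2 : ℝ) : ℂ) := by
    rw [← inner_conj_symm, hform, Complex.conj_ofReal]
  rw [h2]
  exact ⟨rfl, by rw [RCLike.re_eq_complex_re, Complex.ofReal_re]; linarith⟩

theorem norm_displacementHom_excessSymbol_le (ε : n → ℝ) (ρ : Matrix n n ℂ) {V : Matrix n n ℂ}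
    (hV : V ∈ Matrix.unitaryGroup n ℂ) :
    ‖displacementHom (excessSymbol ε ρ V)‖
      ≤ ∑ i, ∑ j, (∑ k, |ε k|) * ‖ρ i j‖ + |passiveEnergy ε ρ| + 1 := by
  refine ContinuousLinearMap.opNorm_le_bound _ (by positivity) fun φ => ?_
  rw [displacementHom_excessSymbol]
  simp only [sub_apply, sum_apply, smul_apply, one_apply_eq_self]
  have h1 : ‖∑ i, ∑ j, (rotatedHamiltonian ε V j i * ρ i j) • displacement (ε i - ε j) φ‖
      ≤ (∑ i, ∑ j, (∑ k, |ε k|) * ‖ρ i j‖) * ‖φ‖ := by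
    rw [Finset.sum_mul]
    refine (norm_sum_le _ _).trans (Finset.sum_le_sum fun i _ => ?_)
    rw [Finset.sum_mul]
    refine (norm_sum_le _ _).trans (Finset.sum_le_sum fun j _ => ?_)
    rw [norm_smul, displacement_norm, norm_mul]
    gcongr
    exact norm_rotatedHamiltonian_apply_le ε hV j i
  refine (norm_sub_le _ _).trans ?_
  rw [norm_smul, Complex.norm_real, Real.norm_eq_abs, add_assoc, add_mul]
  gcongr
  linarith

/-! ### The control-marginal state as an expectation over the weight -/

/-- Cyclicity for the Hilbert–Schmidt operators Γ√ρ_W moves the displacements onto the vectors √ρ_W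
b_k, so that estimates valid for each vector can be summed over k. -/
theorem controlMarginal_apply (ε : n → ℝ) (ρS : Matrix n n ℂ)
    {ρW : WeightSpace →L[ℂ] WeightSpace} (hρW : IsDensityOperator ρW) (i j : n) :
    (Summable fun k => ⟪displacement (ε j) (operatorSqrt ρW (weightBasis k)),
        displacement (ε i) (operatorSqrt ρW (weightBasis k))⟫_ℂ) ∧
    controlMarginal ε ρS ρW i j = ρS i j *
      ∑' k, ⟪displacement (ε j) (operatorSqrt ρW (weightBasis k)),
        displacement (ε i) (operatorSqrt ρW (weightBasis k))⟫_ℂ := by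
  set R := operatorSqrt ρW
  have hHS : ∀ a, hilbertSchmidtSq (displacement a * R) ≠ ∞ := fun a => by
    refine ne_top_of_le_ne_top ?_ (hilbertSchmidtSq_le (B := R) fun φ =>
      (displacement_norm a (R φ)).le)
    rw [hρW.hilbertSchmidtSq_operatorSqrt]
    exact ENNReal.one_ne_top
  obtain ⟨h1, h2⟩ := tsum_inner_adjoint (hHS (ε i)) (hHS (ε j))
  refine ⟨h1, ?_⟩
  have h3 : ∀ a, ContinuousLinearMap.adjoint (displacement a * R)
      = R * ContinuousLinearMap.adjoint (displacement a) := fun a => by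
    have hR : ContinuousLinearMap.adjoint R = R := operatorSqrt_adjoint ρW
    refine (ContinuousLinearMap.adjoint_comp _ _).trans ?_
    rw [hR]
    rfl
  have h4 : (controlOperator ε * tensor ρS ρW * star (controlOperator ε)) i j
      = ρS i j • (displacement (ε i) * ρW * ContinuousLinearMap.adjoint (displacement (ε j))) := by
    rw [controlOperator, Matrix.star_eq_conjTranspose, Matrix.diagonal_conjTranspose,
      Matrix.mul_diagonal, Matrix.diagonal_mul, tensor, Matrix.of_apply, mul_smul_comm,
      smul_mul_assoc]
    rfl
  rw [controlMarginal, partialTraceWeight, Matrix.of_apply, h4, weightTrace]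
  simp only [smul_apply, inner_smul_right]
  rw [tsum_mul_left]
  refine congrArg (ρS i j * ·) (Eq.trans (tsum_congr fun k => ?_) h2)
  rw [h3, h3, mul_apply_eq_comp, mul_apply_eq_comp, ← ContinuousLinearMap.adjoint_inner_left,
    inner_apply_eq_operatorSqrt hρW.isPositive]
  rfl

/-- On the diagonal the two displacements are equal and preserve norms. Hence σ_S and ρ_S have the
same mean energy, and their ergotropies differ only through the rotated term. -/
theorem controlMarginal_diag (ε : n → ℝ) (ρS : Matrix n n ℂ)
    {ρW : WeightSpace →L[ℂ] WeightSpace} (hρW : IsDensityOperator ρW) (i : n) :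
    controlMarginal ε ρS ρW i i = ρS i i := by
  have h1 := hasSum_norm_sq (A := operatorSqrt ρW)
    (by rw [hρW.hilbertSchmidtSq_operatorSqrt]; exact ENNReal.one_ne_top)
  rw [hρW.hilbertSchmidtSq_operatorSqrt, ENNReal.toReal_one] at h1
  have h2 : ∀ φ : WeightSpace, ⟪φ, φ⟫_ℂ = ((‖φ‖ ^ 2 : ℝ) : ℂ) := fun φ => by
    rw [inner_self_eq_norm_sq_to_K]; norm_cast
  rw [(controlMarginal_apply ε ρS hρW i i).2]
  simp only [h2, displacement_norm]
  rw [← Complex.ofReal_tsum, h1.tsum_eq, Complex.ofReal_one, mul_one]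

theorem hasSum_inner_excess (ε : n → ℝ) (ρS V : Matrix n n ℂ)
    {ρW : WeightSpace →L[ℂ] WeightSpace} (hρW : IsDensityOperator ρW) :
    HasSum (fun k => (⟪operatorSqrt ρW (weightBasis k), displacementHom (excessSymbol ε ρS V)
        (operatorSqrt ρW (weightBasis k))⟫_ℂ).re)
      (ergotropy ε ρS - ((workOperator ε V * controlMarginal ε ρS ρW).trace).re) := by
  have h1 := hasSum_norm_sq (A := operatorSqrt ρW)
    (by rw [hρW.hilbertSchmidtSq_operatorSqrt]; exact ENNReal.one_ne_top)
  rw [hρW.hilbertSchmidtSq_operatorSqrt, ENNReal.toReal_one] at h1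
  have h2 : HasSum (fun k => ⟪operatorSqrt ρW (weightBasis k),
      displacementHom (excessSymbol ε ρS V) (operatorSqrt ρW (weightBasis k))⟫_ℂ)
      (∑ i, ∑ j, rotatedHamiltonian ε V j i * controlMarginal ε ρS ρW i j
        - passiveEnergy ε ρS * ((1 : ℝ) : ℂ)) := by
    simp only [inner_excess]
    refine HasSum.sub (hasSum_sum fun i _ => hasSum_sum fun j _ => ?_)
      ((Complex.hasSum_ofReal.2 h1).mul_left _)
    obtain ⟨h3, h4⟩ := controlMarginal_apply ε ρS hρW i j
    rw [h4, ← mul_assoc]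
    exact h3.hasSum.mul_left _
  have h5 := Complex.hasSum_re h2
  have h6 : (∑ i, ∑ j, rotatedHamiltonian ε V j i * controlMarginal ε ρS ρW i j)
      = (rotatedHamiltonian ε V * controlMarginal ε ρS ρW).trace := by
    rw [Matrix.trace, Finset.sum_comm]
    refine Finset.sum_congr rfl fun i _ => ?_
    rw [Matrix.diag_apply, Matrix.mul_apply]
  have h7 : (systemHamiltonian ε * controlMarginal ε ρS ρW).trace
      = (systemHamiltonian ε * ρS).trace := by
    simp only [Matrix.trace, Matrix.diag_apply, systemHamiltonian, Matrix.diagonal_mul,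
      controlMarginal_diag ε ρS hρW]
  rw [h6] at h5
  convert h5 using 1
  rw [workOperator_mul_trace, h7, passiveEnergy, Complex.sub_re, Complex.sub_re,
    ← Complex.ofReal_mul, Complex.ofReal_re]
  ring

/-- If the weight is concentrated in an energy interval of a given length, then the ergotropy of the
control-marginal state stays below the ergotropy of the system by a fixed amount. -/
theorem exists_ergotropy_controlMarginal_add_le (ε : n → ℝ) {ρS : Matrix n n ℂ}
    (hρS : IsDensityMatrix ρS) (hcoh : 0 < coherentErgotropy ε ρS) :
    ∃ η : ℝ≥0∞, 0 < η ∧ ∀ L : ℝ, 0 ≤ L → ∃ δ : ℝ, 0 < δ ∧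
      ∀ ρW : WeightSpace →L[ℂ] WeightSpace, IsDensityOperator ρW → ∀ m : ℝ,
        energyDistribution ρW (Metric.closedBall m L)ᶜ ≤ η →
        ergotropy ε (controlMarginal ε ρS ρW) + δ ≤ ergotropy ε ρS := by
  have h0 : 0 ∈ energyGaps ε := Finset.mem_insert_self _ _
  set d : ℝ := ((energyGaps ε).card : ℝ) with hd
  have hd0 : 0 < d := Nat.cast_pos.2 (Finset.card_pos.2 ⟨0, h0⟩)
  -- With this tail the term 128 d² η equals 1/2, half of the total trace; the choice precedes `L`.
  refine ⟨ENNReal.ofReal (1 / (256 * d ^ 2)), ENNReal.ofReal_pos.2 (by positivity), ?_⟩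
  intro L hL
  obtain ⟨C, hC, hkey⟩ := norm_sq_le_inner_add_cutoff h0 hcoh
    (M := ∑ i, ∑ j, (∑ k, |ε k|) * ‖ρS i j‖ + |passiveEnergy ε ρS| + 1) (by positivity) hL
  refine ⟨1 / (2 * C), by positivity, fun ρW hρW m hm => ?_⟩
  rw [← le_sub_iff_add_le]
  -- The constant `C` serves all `V` at once, so the deficit survives the supremum.
  refine ergotropy_le fun V hV => ?_
  have hherm := hρS.posSemidef.isHermitian
  have hc : coherentErgotropy ε ρS ≤ ‖(excessSymbol ε ρS V).coeff 0‖ := by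
    refine le_trans ?_ (Complex.re_le_norm _)
    have := passiveEnergy_add_coherentErgotropy_le ε hV hherm
    rw [excessSymbol_coeff_zero, Complex.sub_re, Complex.ofReal_re]
    linarith
  have hineq := fun φ => hkey (excessSymbol ε ρS V) (excessSymbol_support_subset ε ρS V) hc
    (displacementHom_excessSymbol_isPositive ε hherm hV)
    (norm_displacementHom_excessSymbol_le ε ρS hV) m φ
  have hB := (measurableSet_closedBall (x := m) (ε := L)).compl
  set P := cutoff hB with hP
  rw [energyDistribution_apply _ hB, ← hP] at hm
  have hfin : hilbertSchmidtSq (P * operatorSqrt ρW) ≠ ∞ :=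
    ne_top_of_le_ne_top ENNReal.ofReal_ne_top hm
  have hm' : (hilbertSchmidtSq (P * operatorSqrt ρW)).toReal ≤ 1 / (256 * d ^ 2) :=
    ENNReal.toReal_le_of_le_ofReal (by positivity) hm
  have s1 := hasSum_norm_sq (A := operatorSqrt ρW)
    (by rw [hρW.hilbertSchmidtSq_operatorSqrt]; exact ENNReal.one_ne_top)
  rw [hρW.hilbertSchmidtSq_operatorSqrt, ENNReal.toReal_one] at s1
  have s2 := hasSum_inner_excess ε ρS V hρW
  have s3 := hasSum_norm_sq hfin
  -- Summed over the vectors √ρ_W b_k, the vectorwise bound reads 1 ≤ C · deficit + 128 d² · tail.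
  have h := hasSum_le (fun k => hineq (operatorSqrt ρW (weightBasis k))) s1
    ((s2.mul_left C).add (s3.mul_left (128 * d ^ 2)))
  have h8 : 128 * d ^ 2 * (hilbertSchmidtSq (P * operatorSqrt ρW)).toReal ≤ 1 / 2 := by
    calc _ ≤ 128 * d ^ 2 * (1 / (256 * d ^ 2)) := by gcongr
      _ = 1 / 2 := by field_simp; norm_num
  have h9 : 1 / 2 ≤ C * (ergotropy ε ρS
      - ((workOperator ε V * controlMarginal ε ρS ρW).trace).re) := by linarith
  have h10 : 1 / (2 * C) ≤ ergotropy ε ρS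
      - ((workOperator ε V * controlMarginal ε ρS ρW).trace).re := by
    rw [div_le_iff₀ (by positivity)]
    linarith
  linarith

end Composite

/-- Chebyshev's inequality for the energy dispersion. -/
theorem exists_energyDistribution_compl_closedBall_le (C : NNReal) {η : ℝ≥0∞} (hη : 0 < η) :
    ∃ L : ℝ, 0 ≤ L ∧ ∀ ρ : WeightSpace →L[ℂ] WeightSpace, energyDispersion ρ ≤ C →
      ∃ m : ℝ, energyDistribution ρ (Metric.closedBall m L)ᶜ ≤ η := by
  -- The threshold is made finite so that real arithmetic applies; the summand 1 in `L` below makes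
  -- `L` positive, as needed to cancel `L²`.
  set η' : ℝ≥0∞ := min η 1 with hη'
  have hη'0 : η' ≠ 0 := (lt_min hη one_pos).ne'
  have hη'1 : η' ≠ ∞ := ne_top_of_le_ne_top ENNReal.one_ne_top (min_le_right _ _)
  have hr : 0 < η'.toReal := ENNReal.toReal_pos hη'0 hη'1
  set L : ℝ := (C : ℝ) / √η'.toReal + 1 with hL
  have hL0 : 0 < L := by positivity
  have hCL : (C : ℝ≥0∞) ^ 2 ≤ ENNReal.ofReal L ^ 2 * η' := by
    rw [← ENNReal.ofReal_toReal hη'1, ← ENNReal.ofReal_pow hL0.le,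
      ← ENNReal.ofReal_mul (by positivity), ← ENNReal.ofReal_coe_nnreal,
      ← ENNReal.ofReal_pow (by positivity)]
    apply ENNReal.ofReal_le_ofReal
    have h1 : (C : ℝ) ≤ L * √η'.toReal := by
      rw [hL, add_mul, div_mul_cancel₀ _ (Real.sqrt_pos.2 hr).ne']
      linarith [Real.sqrt_nonneg η'.toReal]
    calc (C : ℝ) ^ 2 ≤ (L * √η'.toReal) ^ 2 := by gcongr
      _ = L ^ 2 * η'.toReal := by rw [mul_pow, Real.sq_sqrt hr.le]
  refine ⟨L, hL0.le, fun ρ hρ => ?_⟩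
  set μ := energyDistribution ρ with hμ
  -- The centre used by the variance. The integral is 0 by default if the mean does not exist, which
  -- is harmless, since Markov's inequality needs only the second moment about this same point.
  refine ⟨∫ E, E ∂μ, le_trans ?_ (min_le_left η 1)⟩
  set m := ∫ E, E ∂μ
  have hvar : ∫⁻ E, ‖E - m‖ₑ ^ 2 ∂μ ≤ (C : ℝ≥0∞) ^ 2 := by
    have h1 : (ProbabilityTheory.evariance (fun E : ℝ => E) μ) ^ (1 / 2 : ℝ) ≤ C := hρ
    have h2 := ENNReal.rpow_le_rpow h1 (zero_le_two (α := ℝ))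
    rw [← ENNReal.rpow_mul] at h2
    norm_num at h2
    exact h2
  have hsub : (Metric.closedBall m L)ᶜ ⊆ {E | ENNReal.ofReal L ^ 2 ≤ ‖E - m‖ₑ ^ 2} := by
    intro E hE
    rw [Set.mem_compl_iff, Metric.mem_closedBall, Real.dist_eq, not_le] at hE
    rw [Set.mem_ofPred_eq, ← ofReal_norm]
    gcongr
    exact hE.le
  have hmarkov := mul_meas_ge_le_lintegral₀ (μ := μ) (f := fun E => ‖E - m‖ₑ ^ 2)
    (by fun_prop) (ENNReal.ofReal L ^ 2)
  have h3 : ENNReal.ofReal L ^ 2 * μ (Metric.closedBall m L)ᶜ ≤ ENNReal.ofReal L ^ 2 * η' :=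
    ((mul_le_mul_right (measure_mono hsub) _).trans hmarkov).trans (hvar.trans hCL)
  refine (ENNReal.mul_le_mul_iff_right ?_ ?_).1 h3
  · exact pow_ne_zero _ (ENNReal.ofReal_pos.2 hL0).ne'
  · finiteness

/-- The order of choices matters: `η` is fixed first, Chebyshev then selects `L` from `C` and `η`,
and only afterwards `δ` is taken for the radius `L + D`, which serves both the initial and the final
state. -/
theorem exists_ergotropy_add_le_of_energyDispersion_le {n : Type*} [Fintype n] [DecidableEq n]
    (ε : n → ℝ) {ρS : Matrix n n ℂ}
    (hρS : IsDensityMatrix ρS) (hcoh : 0 < coherentErgotropy ε ρS) (C : NNReal) :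
    ∃ δ : ℝ, 0 < δ ∧ ∀ (ρW : WeightSpace →L[ℂ] WeightSpace) (U : CompositeOperator n),
      IsDensityOperator ρW → IsWorkExtraction ε U →
      energyDispersion ρW ≤ C ∨ energyDispersion (finalWeightState U ρS ρW) ≤ C →
      ergotropy ε (controlMarginal ε ρS ρW) + δ ≤ ergotropy ε ρS := by
  obtain ⟨η, hη, hcore⟩ := exists_ergotropy_controlMarginal_add_le ε hρS hcoh
  obtain ⟨L, hL, hcheb⟩ := exists_energyDistribution_compl_closedBall_le C hη
  set D : ℝ := ∑ i, ∑ j, |ε i - ε j|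
  have hD : ∀ i j, |ε i - ε j| ≤ D := fun i j =>
    (Finset.single_le_sum (f := fun j => |ε i - ε j|) (fun _ _ => abs_nonneg _)
      (Finset.mem_univ j)).trans
      (Finset.single_le_sum (f := fun i => ∑ j, |ε i - ε j|)
        (fun _ _ => Finset.sum_nonneg fun _ _ => abs_nonneg _) (Finset.mem_univ i))
  have hD0 : 0 ≤ D := Finset.sum_nonneg fun _ _ => Finset.sum_nonneg fun _ _ => abs_nonneg _
  obtain ⟨δ, hδ, hδL⟩ := hcore (L + D) (by positivity)
  refine ⟨δ, hδ, fun ρW U hρW hU h => ?_⟩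
  rcases h with h | h
  · obtain ⟨m, hm⟩ := hcheb _ h
    refine hδL ρW hρW m ((measure_mono ?_).trans hm)
    exact Set.compl_subset_compl.2 (Metric.closedBall_subset_closedBall (by linarith))
  · obtain ⟨m, hm⟩ := hcheb _ h
    exact hδL ρW hρW m
      ((energyDistribution_compl_closedBall_le hU hρS hρW.isPositive hD m L).trans hm)

end

end QuantumWeight

theorem mainTheorem6 {n : Type*} [Fintype n] [DecidableEq n] (ε : n → ℝ) (ρS : Matrix n n ℂ)
    (hρS : QuantumWeight.IsDensityMatrix ρS)
    (hcoh : 0 < QuantumWeight.coherentErgotropy ε ρS) :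
    (∀ (ρW : QuantumWeight.WeightSpace →L[ℂ] QuantumWeight.WeightSpace)
        (U : QuantumWeight.CompositeOperator n),
      QuantumWeight.IsDensityOperator ρW → QuantumWeight.IsWorkExtraction ε U →
      QuantumWeight.ergotropy ε ρS =
        QuantumWeight.ergotropy ε (QuantumWeight.controlMarginal ε ρS ρW) →
      QuantumWeight.energyDispersion ρW = ⊤ ∧
        QuantumWeight.energyDispersion (QuantumWeight.finalWeightState U ρS ρW) = ⊤) ∧
    (∀ (ρW : ℕ → QuantumWeight.WeightSpace →L[ℂ] QuantumWeight.WeightSpace)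
        (U : ℕ → QuantumWeight.CompositeOperator n),
      (∀ k, QuantumWeight.IsDensityOperator (ρW k)) →
      (∀ k, QuantumWeight.IsWorkExtraction ε (U k)) →
      Filter.Tendsto
        (fun k => QuantumWeight.ergotropy ε (QuantumWeight.controlMarginal ε ρS (ρW k)))
        Filter.atTop (𝓝 (QuantumWeight.ergotropy ε ρS)) →
      Filter.Tendsto (fun k => QuantumWeight.energyDispersion (ρW k)) Filter.atTop (𝓝 ⊤) ∧
        Filter.Tendsto
          (fun k => QuantumWeight.energyDispersion
            (QuantumWeight.finalWeightState (U k) ρS (ρW k)))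
          Filter.atTop (𝓝 ⊤)) := by
  constructor
  · intro ρW U hρW hU heq
    have key : ∀ C : NNReal,
        ¬ (QuantumWeight.energyDispersion ρW ≤ C ∨
          QuantumWeight.energyDispersion (QuantumWeight.finalWeightState U ρS ρW) ≤ C) := by
      intro C hC
      obtain ⟨δ, hδ, h⟩ :=
        QuantumWeight.exists_ergotropy_add_le_of_energyDispersion_le ε hρS hcoh C
      have := h ρW U hρW hU hC
      linarith
    exact ⟨ENNReal.eq_top_of_forall_nnreal_le fun C => (not_le.1 fun h => key C (Or.inl h)).le,
      ENNReal.eq_top_of_forall_nnreal_le fun C => (not_le.1 fun h => key C (Or.inr h)).le⟩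
  · intro ρW U hρW hU hlim
    have key : ∀ C : NNReal, ∀ᶠ k in Filter.atTop,
        ¬ (QuantumWeight.energyDispersion (ρW k) ≤ C ∨
          QuantumWeight.energyDispersion (QuantumWeight.finalWeightState (U k) ρS (ρW k)) ≤ C) := by
      intro C
      obtain ⟨δ, hδ, h⟩ :=
        QuantumWeight.exists_ergotropy_add_le_of_energyDispersion_le ε hρS hcoh C
      -- Since `δ` does not depend on `k`, the ergotropies eventually exceed R(ρ_S) - δ, which
      -- excludes both dispersion bounds.
      filter_upwards [hlim.eventually (lt_mem_nhds (sub_lt_self _ hδ))] with k hk hC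
      have := h (ρW k) (U k) (hρW k) (hU k) hC
      linarith
    constructor
    · refine ENNReal.tendsto_nhds_top_iff_nnreal.2 fun C => ?_
      filter_upwards [key C] with k hk
      exact not_le.1 fun h => hk (Or.inl h)
    · refine ENNReal.tendsto_nhds_top_iff_nnreal.2 fun C => ?_
      filter_upwards [key C] with k hk
      exact not_le.1 fun h => hk (Or.inr h)
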